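/- Let $k$ be a field. An endomorphism of $\mathbb{A}^3=\mathbb{A}^3_k$ is a triple $f=(f_1,f_2,f_3)$ of polynomials in $k[x_1,x_2,x_3]$; endomorphisms form a monoid under composition, whose invertible elements are the automorphisms of $\mathbb{A}^3$. Put $\deg f=\max(\deg f_1,\deg f_2,\deg f_3)$. The dynamical degree of an automorphism $f$ is $\lambda(f)=\lim_{r\to\infty}\deg(f^r)^{1/r}$ (the limit exists). An endomorphism is triangular if $f_i\in k[x_1,\dots,x_i]$ for $i=1,2,3$; an affine automorphism is an automorphism of degree $1$; and $f$ is affine-triangular if $f=\alpha\circ\tau$ with $\alpha$ an affine automorphism and $\tau$ a triangular endomorphism. For each field $k$ and each integer $d\ge 2$, the set of dynamical degrees of all affine-triangular automorphisms of $\mathbb{A}^3_k$ of degree $\le d$ is equal to \[ \left\{\frac{a+\sqrt{a^2+4bc}}{2}\;\middle|\;(a,b,c)\in\mathbb{N}^3,\ a+b\le d,\ c\le d\right\}\setminus\{0\}, \] where $\mathbb{N}=\{0,1,2,\dots\}$. Moreover, for all $a,b,c\in\mathbb{N}$ such that $\lambda=\frac{a+\sqrt{a^2+4bc}}{2}\neq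 0$, both \[ (x_3+x_1^ax_2^b,\;x_2+x_1^c,\;x_1)\quad\text{and}\quad(x_3+x_1^ax_2^{bc},\;x_1,\;x_2) \] are affine-triangular automorphisms of $\mathbb{A}^3_k$ with dynamical degree $\lambda$. -/

import Mathlib

/-- A polynomial endomorphism `(f₁, …, fₙ)` of affine `n`-space over `k`. The coordinates are
indexed from `0`: `coord 0` is `f₁`, and `MvPolynomial.X 0` is `x₁`. -/
@[ext]
structure PolyEnd (k : Type*) [Field k] (n : ℕ) where
  coord : Fin n → MvPolynomial (Fin n) k

namespace PolyEnd

variable {k : Type*} [Field k] {n : ℕ}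

/-- The monoid of polynomial endomorphisms under composition:
`(f * g)ᵢ = fᵢ(g₁, …, gₙ)` and `1 = (x₁, …, xₙ)`.
Automorphisms of affine space are the invertible elements, `IsUnit f`. -/
noncomputable instance : Monoid (PolyEnd k n) where
  mul f g := ⟨fun i => MvPolynomial.bind₁ g.coord (f.coord i)⟩
  one := ⟨MvPolynomial.X⟩
  mul_assoc f g h := by
    apply PolyEnd.ext
    funext i
    exact MvPolynomial.bind₁_bind₁ g.coord h.coord (f.coord i)
  one_mul f := by
    apply PolyEnd.ext
    funext i
    exact MvPolynomial.bind₁_X_right f.coord i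
  mul_one f := by
    apply PolyEnd.ext
    funext i
    exact DFunLike.congr_fun MvPolynomial.bind₁_X_left (f.coord i)

/-- The degree `max (deg f₁, …, deg fₙ)`. -/
def degree (f : PolyEnd k n) : ℕ :=
  Finset.univ.sup fun i => (f.coord i).totalDegree

/-- `f` is triangular if `fᵢ ∈ k[x₁, …, xᵢ]` for each `i`. -/
def IsTriangular (f : PolyEnd k n) : Prop :=
  ∀ i, f.coord i ∈ MvPolynomial.supported k (Set.Iic i)

/-- An affine automorphism is an automorphism of degree `1`. -/
def IsAffineAut (f : PolyEnd k n) : Prop :=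
  IsUnit f ∧ f.degree = 1

/-- `f` is affine-triangular if `f = α ∘ τ` with `α` an affine automorphism and `τ` a triangular
endomorphism. -/
def IsAffineTriangular (f : PolyEnd k n) : Prop :=
  ∃ α τ : PolyEnd k n, α.IsAffineAut ∧ τ.IsTriangular ∧ f = α * τ

/-- The dynamical degree, the limit of `deg(f ^ r) ^ (1 / r)` as `r → ∞`; the limit exists for
every automorphism by `tendsto_dynamicalDegree`. -/
noncomputable def dynamicalDegree (f : PolyEnd k n) : ℝ :=
  Filter.limUnder Filter.atTop fun r : ℕ => ((f ^ r).degree : ℝ) ^ (1 / (r : ℝ))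

theorem totalDegree_coord_le (f : PolyEnd k n) (i : Fin n) :
    (f.coord i).totalDegree ≤ f.degree :=
  Finset.le_sup (f := fun i => (f.coord i).totalDegree) (Finset.mem_univ i)

theorem degree_mul_le (f g : PolyEnd k n) : (f * g).degree ≤ f.degree * g.degree := by
  refine Finset.sup_le fun i _ => ?_
  refine le_trans ?_ (Nat.mul_le_mul_right g.degree (f.totalDegree_coord_le i))
  change (MvPolynomial.bind₁ g.coord (f.coord i)).totalDegree ≤ _
  generalize f.coord i = p
  conv_lhs => rw [p.as_sum, map_sum]
  refine MvPolynomial.totalDegree_finsetSum_le fun s hs => ?_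
  rw [MvPolynomial.bind₁_monomial]
  refine (MvPolynomial.totalDegree_mul _ _).trans ?_
  rw [MvPolynomial.totalDegree_C, zero_add]
  refine (MvPolynomial.totalDegree_finsetProd _ _).trans ?_
  refine le_trans ?_ (Nat.mul_le_mul_right g.degree (MvPolynomial.le_totalDegree hs))
  rw [Finsupp.sum, Finset.sum_mul]
  refine Finset.sum_le_sum fun j _ => ?_
  exact (MvPolynomial.totalDegree_pow _ _).trans
    (Nat.mul_le_mul_left _ (g.totalDegree_coord_le j))

theorem one_le_degree (hn : 0 < n) {f : PolyEnd k n} (hf : IsUnit f) : 1 ≤ f.degree := by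
  obtain ⟨u, rfl⟩ := hf
  by_contra! h
  have h0 : (u : PolyEnd k n).degree = 0 := by lia
  have h1 := degree_mul_le (↑u⁻¹ : PolyEnd k n) (u : PolyEnd k n)
  rw [Units.inv_mul, h0, mul_zero] at h1
  have h2 := (totalDegree_coord_le (1 : PolyEnd k n) ⟨0, hn⟩).trans h1
  change (MvPolynomial.X _ : MvPolynomial (Fin n) k).totalDegree ≤ 0 at h2
  rw [MvPolynomial.totalDegree_X] at h2
  lia

/-- The limit that defines the dynamical degree exists for automorphisms. -/
theorem tendsto_dynamicalDegree (hn : 0 < n) {f : PolyEnd k n} (hf : IsUnit f) :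
    Filter.Tendsto (fun r : ℕ => ((f ^ r).degree : ℝ) ^ (1 / (r : ℝ))) Filter.atTop
      (nhds f.dynamicalDegree) := by
  have hpos : ∀ r : ℕ, (1 : ℝ) ≤ ((f ^ r).degree : ℝ) := fun r => by
    exact_mod_cast one_le_degree hn (hf.pow r)
  have hsub : Subadditive fun r : ℕ => Real.log ((f ^ r).degree : ℝ) := by
    intro r s
    rw [← Real.log_mul (by linarith [hpos r]) (by linarith [hpos s])]
    refine Real.log_le_log (by linarith [hpos (r + s)]) ?_
    rw [pow_add]
    exact_mod_cast degree_mul_le (f ^ r) (f ^ s)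
  have hbdd : BddBelow (Set.range fun r : ℕ => Real.log ((f ^ r).degree : ℝ) / r) := by
    refine ⟨0, ?_⟩
    rintro _ ⟨r, rfl⟩
    exact div_nonneg (Real.log_nonneg (hpos r)) (Nat.cast_nonneg r)
  have hlim := (Real.continuous_exp.tendsto _).comp (hsub.tendsto_lim hbdd)
  refine tendsto_nhds_limUnder ⟨Real.exp hsub.lim, hlim.congr fun r => ?_⟩
  rw [Real.rpow_def_of_pos (by linarith [hpos r])]
  simp [div_eq_mul_inv]

end PolyEnd

/-
Bound `f.dynamicalDegree` above and below by weights `w ≥ 0` on the variables. If each `fᵢ` has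
weighted degree at most `θ * wᵢ`, then so do the iterates with `θ ^ r`, and the dynamical degree is
at most `θ`. If moreover the parts `gᵢ` of weighted degree exactly `θ * wᵢ` have nonzero iterates,
there is no cancellation and the dynamical degree equals `θ`; weights for which this holds are the
eigenvectors of a matrix of exponents, so that `θ ^ 2 = a * θ + b * c`.

By the Bruhat decomposition, an affine-triangular automorphism is conjugate to the composition of a
permutation of the coordinates and a triangular automorphism of no larger degree. Each of the six
permutations of three coordinates is then brought, by conjugation with elementary or Hénon
automorphisms where necessary, to a form with an explicit leading part.
-/

open MvPolynomial

section Weights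

variable {σ ι R M : Type*} [CommRing R]

/-- The polynomials all of whose monomials have their `w`-weight in `S`. With `S = Set.Iic D` this
is the filtration by weighted degree, without the need for a degree of the zero polynomial. -/
noncomputable def weightSubmodule [AddCommMonoid M] (R : Type*) [CommRing R] (w : σ → M)
    (S : Set M) : Submodule R (MvPolynomial σ R) :=
  restrictSupport R (Finsupp.weight w ⁻¹' S)

section Monoid

variable [AddCommMonoid M] {w : σ → M} {S T U : Set M} {p q : MvPolynomial σ R}

theorem mem_weightSubmodule_iff :
    p ∈ weightSubmodule R w S ↔ ∀ m ∈ p.support, Finsupp.weight w m ∈ S := Iff.rfl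

theorem weightSubmodule_mono (h : S ⊆ T) : weightSubmodule R w S ≤ weightSubmodule R w T :=
  restrictSupport_mono R (Set.preimage_mono h)

theorem monomial_mem_weightSubmodule {m : σ →₀ ℕ} (h : Finsupp.weight w m ∈ S) (a : R) :
    monomial m a ∈ weightSubmodule R w S :=
  (monomial_mem_restrictSupport R).2 (Or.inl h)

theorem C_mem_weightSubmodule (h : 0 ∈ S) (a : R) : C a ∈ weightSubmodule R w S :=
  monomial_mem_weightSubmodule (by rwa [map_zero]) a

theorem X_mem_weightSubmodule {i : σ} (h : w i ∈ S) : X i ∈ weightSubmodule R w S :=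
  monomial_mem_weightSubmodule (by rwa [Finsupp.weight_single, one_smul]) 1

theorem mul_mem_weightSubmodule (hp : p ∈ weightSubmodule R w S) (hq : q ∈ weightSubmodule R w T)
    (hU : ∀ a ∈ S, ∀ b ∈ T, a + b ∈ U) : p * q ∈ weightSubmodule R w U := by
  classical
  intro m hm
  obtain ⟨a, ha, b, hb, rfl⟩ := Finset.mem_add.1 (support_mul p q hm)
  rw [Set.mem_preimage, map_add]
  exact hU _ (hp ha) _ (hq hb)

theorem C_mul_mem_weightSubmodule (hp : p ∈ weightSubmodule R w S) (a : R) :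
    C a * p ∈ weightSubmodule R w S := by
  rw [← smul_eq_C_mul]
  exact Submodule.smul_mem _ a hp

theorem C_mul_X_mem_weightSubmodule {i : σ} (h : w i ∈ S) (a : R) :
    C a * X i ∈ weightSubmodule R w S :=
  C_mul_mem_weightSubmodule (X_mem_weightSubmodule h) a

theorem weight_comp {N : Type*} [AddCommMonoid N] (φ : M →+ N) (w : σ → M) (m : σ →₀ ℕ) :
    Finsupp.weight (φ ∘ w) m = φ (Finsupp.weight w m) := by
  simp [Finsupp.weight_apply, Finsupp.sum, map_sum, map_nsmul]

theorem mem_weightSubmodule_Iic_comp [Preorder M] {N : Type*} [AddCommMonoid N] [Preorder N]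
    {φ : M →+ N} (hφ : Monotone φ) {D : M} (hp : p ∈ weightSubmodule R w (Set.Iic D)) :
    p ∈ weightSubmodule R (φ ∘ w) (Set.Iic (φ D)) :=
  mem_weightSubmodule_iff.2 fun m hm => by
    rw [weight_comp]
    exact hφ (mem_weightSubmodule_iff.1 hp m hm)

theorem isWeightedHomogeneous_iff_mem_weightSubmodule {D : M} :
    IsWeightedHomogeneous w p D ↔ p ∈ weightSubmodule R w {D} :=
  forall_congr' fun _ => imp_congr_left mem_support_iff.symm

/-- `G` is the part of `p` of `w`-weight `D`, and the rest of `p` has smaller weight.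
Here `G = 0` is allowed. -/
structure IsLeadingPart [Preorder M] (w : σ → M) (D : M) (p G : MvPolynomial σ R) : Prop where
  isWeightedHomogeneous : IsWeightedHomogeneous w G D
  sub_mem : p - G ∈ weightSubmodule R w (Set.Iio D)

end Monoid

variable [AddCommMonoid M] [PartialOrder M] {w : σ → M} {D E : M} {p q G H : MvPolynomial σ R}

theorem IsLeadingPart.mem_weightSubmodule (h : IsLeadingPart w D p G) :
    p ∈ weightSubmodule R w (Set.Iic D) := by
  rw [← sub_add_cancel p G]
  exact add_mem (weightSubmodule_mono Set.Iio_subset_Iic_self h.sub_mem)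
    (weightSubmodule_mono (Set.singleton_subset_iff.2 Set.self_mem_Iic)
      (isWeightedHomogeneous_iff_mem_weightSubmodule.1 h.isWeightedHomogeneous))

theorem isLeadingPart_zero (h : p ∈ weightSubmodule R w (Set.Iio D)) : IsLeadingPart w D p 0 :=
  ⟨isWeightedHomogeneous_zero R w D, by rwa [sub_zero]⟩

theorem isLeadingPart_self (h : IsWeightedHomogeneous w p D) : IsLeadingPart w D p p :=
  ⟨h, by rw [sub_self]; exact zero_mem _⟩

theorem isLeadingPart_X (i : σ) : IsLeadingPart w (w i) (X i : MvPolynomial σ R) (X i) :=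
  isLeadingPart_self (isWeightedHomogeneous_X R w i)

theorem isLeadingPart_weightedHomogeneousComponent (h : p ∈ weightSubmodule R w (Set.Iic D)) :
    IsLeadingPart w D p (weightedHomogeneousComponent w D p) := by
  classical
  refine ⟨weightedHomogeneousComponent_isWeightedHomogeneous D p,
    mem_weightSubmodule_iff.2 fun m hm => ?_⟩
  rw [mem_support_iff, coeff_sub, coeff_weightedHomogeneousComponent] at hm
  split_ifs at hm with hD
  · exact absurd (sub_self _) hm
  · rw [sub_zero] at hm
    exact lt_of_le_of_ne (mem_weightSubmodule_iff.1 h m (mem_support_iff.2 hm)) hD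

theorem IsLeadingPart.add (hp : IsLeadingPart w D p G) (hq : IsLeadingPart w D q H) :
    IsLeadingPart w D (p + q) (G + H) :=
  ⟨hp.isWeightedHomogeneous.add hq.isWeightedHomogeneous, by
    rw [add_sub_add_comm]; exact add_mem hp.sub_mem hq.sub_mem⟩

theorem IsLeadingPart.add_of_lt (hp : IsLeadingPart w D p G)
    (hq : q ∈ weightSubmodule R w (Set.Iio D)) : IsLeadingPart w D (p + q) G := by
  simpa using hp.add (isLeadingPart_zero hq)

theorem IsLeadingPart.sum {s : Finset ι} {f g : ι → MvPolynomial σ R}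
    (h : ∀ i ∈ s, IsLeadingPart w D (f i) (g i)) :
    IsLeadingPart w D (∑ i ∈ s, f i) (∑ i ∈ s, g i) :=
  ⟨IsWeightedHomogeneous.sum s g D fun i hi => (h i hi).isWeightedHomogeneous, by
    rw [← Finset.sum_sub_distrib]; exact sum_mem fun i hi => (h i hi).sub_mem⟩

theorem IsLeadingPart.coeff_eq (h : IsLeadingPart w D p G) {m : σ →₀ ℕ}
    (hm : Finsupp.weight w m = D) : coeff m p = coeff m G := by
  by_contra hne
  have hmem : m ∈ (p - G).support := by
    rwa [mem_support_iff, coeff_sub, sub_ne_zero]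
  exact (mem_weightSubmodule_iff.1 h.sub_mem m hmem).ne hm

theorem IsLeadingPart.exists_mem_support (h : IsLeadingPart w D p G) (hG : G ≠ 0) :
    ∃ m ∈ p.support, m ∈ G.support ∧ Finsupp.weight w m = D := by
  obtain ⟨m, hm⟩ := support_nonempty.2 hG
  have hmD := h.isWeightedHomogeneous (mem_support_iff.1 hm)
  exact ⟨m, by rwa [mem_support_iff, h.coeff_eq hmD, ← mem_support_iff], hm, hmD⟩

theorem IsLeadingPart.ne_zero (h : IsLeadingPart w D p G) (hG : G ≠ 0) : p ≠ 0 := by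
  obtain ⟨m, hm, -⟩ := h.exists_mem_support hG
  exact support_nonempty.1 ⟨m, hm⟩

theorem IsLeadingPart.comp {N : Type*} [AddCommMonoid N] [PartialOrder N] {φ : M →+ N}
    (hφ : StrictMono φ) (h : IsLeadingPart w D p G) : IsLeadingPart (φ ∘ w) (φ D) p G where
  isWeightedHomogeneous m hm := by rw [weight_comp, h.isWeightedHomogeneous hm]
  sub_mem := mem_weightSubmodule_iff.2 fun m hm => by
    rw [weight_comp]
    exact hφ (mem_weightSubmodule_iff.1 h.sub_mem m hm)

section OrderedCancel

variable [IsOrderedCancelAddMonoid M]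

instance weightSubmodule_Iic_gradedMonoid (w : σ → M) :
    SetLike.GradedMonoid fun D => weightSubmodule R w (Set.Iic D) where
  one_mem := by
    rw [← C_1]
    exact C_mem_weightSubmodule Set.self_mem_Iic 1
  mul_mem _ _ _ _ hp hq :=
    mul_mem_weightSubmodule hp hq fun _ ha _ hb => Set.mem_Iic.2 (add_le_add ha hb)

theorem IsLeadingPart.mul (hp : IsLeadingPart w D p G) (hq : IsLeadingPart w E q H) :
    IsLeadingPart w (D + E) (p * q) (G * H) := by
  refine ⟨hp.isWeightedHomogeneous.mul hq.isWeightedHomogeneous, ?_⟩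
  rw [show p * q - G * H = (p - G) * q + G * (q - H) by ring]
  refine add_mem (mul_mem_weightSubmodule hp.sub_mem hq.mem_weightSubmodule fun a ha b hb => ?_)
    (mul_mem_weightSubmodule (isWeightedHomogeneous_iff_mem_weightSubmodule.1
      hp.isWeightedHomogeneous) hq.sub_mem fun a ha b hb => ?_)
  · exact add_lt_add_of_lt_of_le ha hb
  · exact add_lt_add_of_le_of_lt (le_of_eq ha) hb

theorem IsLeadingPart.pow (h : IsLeadingPart w D p G) (n : ℕ) :
    IsLeadingPart w (n • D) (p ^ n) (G ^ n) := by
  induction n with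
  | zero => simpa using isLeadingPart_self (isWeightedHomogeneous_one R w)
  | succ n ih => simpa only [pow_succ, succ_nsmul] using ih.mul h

theorem IsLeadingPart.prod {s : Finset ι} {f g : ι → MvPolynomial σ R} {d : ι → M}
    (h : ∀ i ∈ s, IsLeadingPart w (d i) (f i) (g i)) :
    IsLeadingPart w (∑ i ∈ s, d i) (∏ i ∈ s, f i) (∏ i ∈ s, g i) := by
  classical
  induction s using Finset.induction_on with
  | empty => simpa using isLeadingPart_self (isWeightedHomogeneous_one R w)
  | insert a s ha ih =>
    rw [Finset.sum_insert ha, Finset.prod_insert ha, Finset.prod_insert ha]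
    exact (h a (Finset.mem_insert_self a s)).mul
      (ih fun i hi => h i (Finset.mem_insert_of_mem hi))

section Substitution

variable {v : ι → M} {S : Set M} {f g : ι → MvPolynomial σ R} {P Q : MvPolynomial ι R}

theorem bind₁_mem_weightSubmodule (hP : P ∈ weightSubmodule R v S) (hS : IsLowerSet S)
    (h : ∀ i ∈ P.vars, f i ∈ weightSubmodule R w (Set.Iic (v i))) :
    bind₁ f P ∈ weightSubmodule R w S := by
  rw [P.as_sum, map_sum]
  refine sum_mem fun m hm => ?_
  rw [bind₁_monomial]
  refine C_mul_mem_weightSubmodule (weightSubmodule_mono (S := Set.Iic (Finsupp.weight v m))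
    (fun x hx => hS hx (mem_weightSubmodule_iff.1 hP m hm)) ?_) _
  rw [Finsupp.weight_apply]
  exact SetLike.prod_pow_mem_graded (A := fun D => weightSubmodule R w (Set.Iic D)) v f m
    fun i hi => h i ((mem_vars_iff_mem_support i).2 ⟨m, hm, hi⟩)

theorem IsLeadingPart.bind₁_monomial {m : ι →₀ ℕ}
    (h : ∀ i ∈ m.support, IsLeadingPart w (v i) (f i) (g i)) (a : R) :
    IsLeadingPart w (Finsupp.weight v m) (bind₁ f (monomial m a)) (bind₁ g (monomial m a)) := by
  rw [MvPolynomial.bind₁_monomial, MvPolynomial.bind₁_monomial, Finsupp.weight_apply,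
    Finsupp.sum, ← zero_add (Finset.sum _ _)]
  exact (isLeadingPart_self (isWeightedHomogeneous_C w a)).mul
    (IsLeadingPart.prod fun i hi => (h i hi).pow (m i))

theorem IsLeadingPart.bind₁ (hP : IsLeadingPart v D P Q)
    (h : ∀ i, IsLeadingPart w (v i) (f i) (g i)) :
    IsLeadingPart w D (bind₁ f P) (bind₁ g Q) := by
  have hQ : IsLeadingPart w D (MvPolynomial.bind₁ f Q) (MvPolynomial.bind₁ g Q) := by
    rw [Q.as_sum, map_sum, map_sum]
    refine IsLeadingPart.sum fun m hm => ?_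
    rw [← hP.isWeightedHomogeneous (mem_support_iff.1 hm)]
    exact IsLeadingPart.bind₁_monomial (fun i _ => h i) _
  have hrest := bind₁_mem_weightSubmodule hP.sub_mem (isLowerSet_Iio D)
    fun i _ => (h i).mem_weightSubmodule
  rw [← add_sub_cancel Q P, map_add]
  exact hQ.add_of_lt hrest

end Substitution

section Aeval

variable {y : MvPolynomial σ R}

theorem aeval_mem_weightSubmodule (hy : y ∈ weightSubmodule R w (Set.Iic D)) (hD : 0 ≤ D)
    (p : Polynomial R) :
    Polynomial.aeval y p ∈ weightSubmodule R w (Set.Iic (p.natDegree • D)) := by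
  rw [Polynomial.aeval_eq_sum_range]
  refine sum_mem fun i hi => Submodule.smul_mem _ _ (weightSubmodule_mono
    (Set.Iic_subset_Iic.2 (nsmul_le_nsmul_left hD (Finset.mem_range_succ_iff.1 hi))) ?_)
  exact SetLike.pow_mem_graded (A := fun D => weightSubmodule R w (Set.Iic D)) i hy

theorem IsLeadingPart.aeval (hy : IsLeadingPart w D y G) (hD : 0 < D) (p : Polynomial R) :
    IsLeadingPart w (p.natDegree • D) (Polynomial.aeval y p)
      (C p.leadingCoeff * G ^ p.natDegree) := by
  rw [Polynomial.aeval_eq_sum_range, Finset.sum_range_succ, add_comm]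
  refine IsLeadingPart.add_of_lt ?_ (sum_mem fun i hi => Submodule.smul_mem _ _
    (weightSubmodule_mono (Set.Iic_subset_Iio.2
      (nsmul_lt_nsmul_left hD (Finset.mem_range.1 hi))) ?_))
  · rw [smul_eq_C_mul, ← zero_add (_ • D)]
    exact (isLeadingPart_self (isWeightedHomogeneous_C w _)).mul (hy.pow _)
  · exact SetLike.pow_mem_graded (A := fun D => weightSubmodule R w (Set.Iic D)) i
      hy.mem_weightSubmodule

end Aeval

end OrderedCancel

end Weights

section Nonvanishing

variable {σ ι R M : Type*} [CommRing R] [AddCommMonoid M] [LinearOrder M]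

theorem exists_isLeadingPart_monomial {w : σ → M} {p : MvPolynomial σ R} (hp : p ≠ 0)
    (hw : Set.InjOn (Finsupp.weight w) (p.support : Set (σ →₀ ℕ))) :
    ∃ m ∈ p.support, (∀ m' ∈ p.support, Finsupp.weight w m' ≤ Finsupp.weight w m) ∧
      IsLeadingPart w (Finsupp.weight w m) p (monomial m (coeff m p)) := by
  classical
  obtain ⟨m, hm, hmax⟩ := p.support.exists_max_image (Finsupp.weight w) (support_nonempty.2 hp)
  refine ⟨m, hm, hmax, isWeightedHomogeneous_monomial w m _ rfl,
    mem_weightSubmodule_iff.2 fun m' hm' => ?_⟩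
  rw [mem_support_iff, coeff_sub, coeff_monomial] at hm'
  split_ifs at hm' with hne
  · exact absurd (by rw [hne, sub_self]) hm'
  · rw [sub_zero, ← mem_support_iff] at hm'
    exact lt_of_le_of_ne (hmax m' hm') fun h => hne (hw hm' hm h).symm

theorem bind₁_ne_zero_of_isLeadingPart [IsDomain R] [IsOrderedCancelAddMonoid M] {w : σ → M}
    {v : ι → M} {f g : ι → MvPolynomial σ R} {P : MvPolynomial ι R} (hP : P ≠ 0)
    (hv : Set.InjOn (Finsupp.weight v) (P.support : Set (ι →₀ ℕ)))
    (h : ∀ i, IsLeadingPart w (v i) (f i) (g i)) (hg : ∀ i ∈ P.vars, g i ≠ 0) :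
    bind₁ f P ≠ 0 := by
  obtain ⟨m, hm, -, hlead⟩ := exists_isLeadingPart_monomial hP hv
  refine (hlead.bind₁ h).ne_zero ?_
  rw [bind₁_monomial]
  exact mul_ne_zero (C_ne_zero.2 (mem_support_iff.1 hm)) (Finset.prod_ne_zero_iff.2 fun i hi =>
    pow_ne_zero _ (hg i ((mem_vars_iff_mem_support i).2 ⟨m, hm, hi⟩)))

end Nonvanishing

theorem apply_eq_zero_of_mem_supported {σ R : Type*} [CommSemiring R] {s : Set σ}
    {p : MvPolynomial σ R} (hp : p ∈ supported R s) {m : σ →₀ ℕ} (hm : m ∈ p.support) {i : σ}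
    (hi : i ∉ s) : m i = 0 := by
  by_contra h
  exact hi (mem_supported.1 hp
    ((mem_vars_iff_mem_support i).2 ⟨m, hm, Finsupp.mem_support_iff.2 h⟩))

theorem bind₁_mem_supported {σ τ R : Type*} [CommSemiring R] {s : Set σ} {t : Set τ}
    {f : σ → MvPolynomial τ R} (hf : ∀ i ∈ s, f i ∈ supported R t) {p : MvPolynomial σ R}
    (hp : p ∈ supported R s) : bind₁ f p ∈ supported R t := by
  rw [supported_eq_adjoin_X] at hp
  have hle : Algebra.adjoin R (X '' s) ≤ (supported R t).comap (bind₁ f) := by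
    refine Algebra.adjoin_le ?_
    rintro _ ⟨i, hi, rfl⟩
    simpa using hf i hi
  exact hle hp

theorem bind₁_eq_self_of_mem_supported {σ R : Type*} [CommRing R] {s : Set σ}
    {t : σ → MvPolynomial σ R} (ht : ∀ i ∈ s, t i = X i) {p : MvPolynomial σ R}
    (hp : p ∈ supported R s) : bind₁ t p = p :=
  hom_congr_vars (f₁ := (bind₁ t).toRingHom) (f₂ := RingHom.id _)
    (RingHom.ext (bind₁ t).commutes)
    (fun i hi _ => (bind₁_X_right t i).trans (ht i (mem_supported.1 hp hi))) rfl

theorem weight_fin_three {M : Type*} [AddCommMonoid M] (w : Fin 3 → M) (m : Fin 3 →₀ ℕ) :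
    Finsupp.weight w m = m 0 • w 0 + m 1 • w 1 + m 2 • w 2 := by
  rw [Finsupp.weight_eq_sum, Fin.sum_univ_three]

theorem Iio_two_fin_three : Set.Iio (2 : Fin 3) = {0, 1} := by
  ext i
  fin_cases i <;> simp

theorem mem_weightSubmodule_iff_of_mem_supported_Iio_two {R : Type*} [CommRing R] {w : Fin 3 → ℝ}
    {S : Set ℝ} {p : MvPolynomial (Fin 3) R} (hp : p ∈ supported R (Set.Iio 2)) :
    p ∈ weightSubmodule R w S ↔ ∀ m ∈ p.support, m 0 * w 0 + m 1 * w 1 ∈ S := by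
  rw [mem_weightSubmodule_iff]
  refine forall₂_congr fun m hm => ?_
  rw [weight_fin_three, apply_eq_zero_of_mem_supported hp hm (i := 2) (by simp), zero_nsmul,
    add_zero, nsmul_eq_mul, nsmul_eq_mul]

theorem weightedHomogeneousComponent_mem_supported {σ R M : Type*} [CommSemiring R]
    [AddCommMonoid M] {s : Set σ} {p : MvPolynomial σ R} (hp : p ∈ supported R s) (w : σ → M)
    (D : M) : weightedHomogeneousComponent w D p ∈ supported R s := by
  classical
  rw [mem_supported] at hp ⊢
  refine fun i hi => hp ?_
  rw [Finset.mem_coe, mem_vars_iff_mem_support] at hi ⊢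
  obtain ⟨m, hm, hmi⟩ := hi
  rw [mem_support_iff, coeff_weightedHomogeneousComponent] at hm
  exact ⟨m, mem_support_iff.2 fun h => hm (by rw [h, ite_self]), hmi⟩

theorem exists_mem_support_apply_eq_degreeOf {σ R : Type*} [CommSemiring R]
    {p : MvPolynomial σ R} (hp : p ≠ 0) (i : σ) : ∃ m ∈ p.support, m i = p.degreeOf i := by
  obtain ⟨m, hm, h⟩ := Finset.exists_mem_eq_sup _ (support_nonempty.2 hp) fun m => m i
  exact ⟨m, hm, by rw [degreeOf_eq_sup, h]⟩

theorem exists_eq_aeval_of_mem_supported_singleton {σ R : Type*} [CommSemiring R] {i : σ}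
    {p : MvPolynomial σ R} (hp : p ∈ supported R {i}) :
    ∃ q : Polynomial R, p = Polynomial.aeval (X i) q := by
  rw [supported_eq_adjoin_X, Set.image_singleton, Algebra.adjoin_singleton_eq_range_aeval] at hp
  obtain ⟨q, rfl⟩ := hp
  exact ⟨q, rfl⟩

theorem aeval_X_mem_supported {σ R : Type*} [CommSemiring R] {s : Set σ} {i : σ} (hi : i ∈ s)
    (q : Polynomial R) : Polynomial.aeval (X i) q ∈ supported R s := by
  refine Algebra.adjoin_mono ?_ (Polynomial.aeval_mem_adjoin_singleton R (X i))
  exact Set.singleton_subset_iff.2 ⟨i, hi, rfl⟩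

theorem bind₁_aeval {σ τ R : Type*} [CommSemiring R] (f : σ → MvPolynomial τ R)
    (y : MvPolynomial σ R) (q : Polynomial R) :
    bind₁ f (Polynomial.aeval y q) = Polynomial.aeval (bind₁ f y) q :=
  (Polynomial.aeval_algHom_apply (bind₁ f) y q).symm

theorem bind₁_ne_zero_of_isWeightedHomogeneous {σ τ R M : Type*} [CommRing R] [IsDomain R]
    [AddCommMonoid M] [PartialOrder M] [IsOrderedCancelAddMonoid M] {w : τ → M} {D : M}
    {f : σ → MvPolynomial τ R} {i : σ} (hf : IsWeightedHomogeneous w (f i) D) (hD : 0 < D)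
    (hf0 : f i ≠ 0) {P : MvPolynomial σ R} (hP : P ∈ supported R {i}) (hP0 : P ≠ 0) :
    bind₁ f P ≠ 0 := by
  obtain ⟨q, rfl⟩ := exists_eq_aeval_of_mem_supported_singleton hP
  have hq : q ≠ 0 := fun h => hP0 (by rw [h, map_zero])
  rw [bind₁_aeval, bind₁_X_right]
  exact ((isLeadingPart_self hf).aeval hD q).ne_zero (mul_ne_zero
    (C_ne_zero.2 (Polynomial.leadingCoeff_ne_zero.2 hq)) (pow_ne_zero _ hf0))

section Pair

variable {σ R : Type*} [CommRing R] {x y : σ} {G : MvPolynomial σ R}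

open Classical in
/-- The weight for which `y` is infinitely heavier than the other variables. -/
noncomputable def lexWeight (y : σ) (i : σ) : ℕ ×ₗ ℕ :=
  if i = y then toLex (1, 0) else toLex (0, 1)

theorem nsmul_toLex (n a b : ℕ) : n • (toLex (a, b) : ℕ ×ₗ ℕ) = toLex (n * a, n * b) := rfl

theorem weight_lexWeight (hxy : x ≠ y) (hG : G ∈ supported R {x, y}) {m : σ →₀ ℕ}
    (hm : m ∈ G.support) : Finsupp.weight (lexWeight y) m = toLex (m y, m x) := by
  classical
  have hsub : m.support ⊆ {x, y} := fun i hi => by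
    by_contra h
    exact Finsupp.mem_support_iff.1 hi (apply_eq_zero_of_mem_supported hG hm (by simpa using h))
  rw [Finsupp.weight_apply,
    Finsupp.sum_of_support_subset m hsub (fun i c => c • lexWeight y i) fun _ _ => zero_nsmul _,
    Finset.sum_pair hxy, lexWeight, lexWeight, if_neg hxy, if_pos rfl, nsmul_toLex, nsmul_toLex,
    ← toLex_add]
  simp

theorem exists_isLeadingPart_lexWeight (hxy : x ≠ y) (hG : G ∈ supported R {x, y})
    (hy : y ∈ G.vars) : ∃ m : σ →₀ ℕ, m y ≠ 0 ∧ coeff m G ≠ 0 ∧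
      IsLeadingPart (lexWeight y) (toLex (m y, m x)) G (monomial m (coeff m G)) := by
  obtain ⟨m₁, hm₁, hm₁y⟩ := (mem_vars_iff_mem_support y).1 hy
  obtain ⟨m, hm, hmax, hlead⟩ := exists_isLeadingPart_monomial (support_nonempty.1 ⟨m₁, hm₁⟩)
    fun a ha b hb hab => by
      rw [weight_lexWeight hxy hG ha, weight_lexWeight hxy hG hb, toLex_inj, Prod.mk.injEq] at hab
      ext i
      by_cases hi : i ∈ ({x, y} : Set σ)
      · rcases hi with rfl | rfl
        exacts [hab.2, hab.1]
      · rw [apply_eq_zero_of_mem_supported hG ha hi, apply_eq_zero_of_mem_supported hG hb hi]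
  rw [weight_lexWeight hxy hG hm] at hlead
  refine ⟨m, fun h0 => ?_, mem_support_iff.1 hm, hlead⟩
  have hle := hmax m₁ hm₁
  rw [weight_lexWeight hxy hG hm, weight_lexWeight hxy hG hm₁, h0, Prod.Lex.le_iff] at hle
  simp only [ofLex_toLex] at hle
  have := Finsupp.mem_support_iff.1 hm₁y
  omega

theorem bind₁_pair_ne_zero [IsDomain R] (hxy : x ≠ y) (hG : G ∈ supported R {x, y})
    (hy : y ∈ G.vars) {p : Polynomial R} (hp : 1 ≤ p.natDegree) {P : MvPolynomial (Fin 3) R}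
    (hP : P ∈ supported R (Set.Iio 2)) (hP0 : P ≠ 0) :
    bind₁ ![G, Polynomial.aeval (X x) p, 0] P ≠ 0 := by
  obtain ⟨m, hmy, hm0, hlead⟩ := exists_isLeadingPart_lexWeight hxy hG hy
  have hlead₁ : IsLeadingPart (lexWeight y) (toLex (0, p.natDegree)) (Polynomial.aeval (X x) p)
      (C p.leadingCoeff * X x ^ p.natDegree) := by
    have h := (isLeadingPart_X (R := R) (w := lexWeight y) x).aeval
      (by rw [lexWeight, if_neg hxy]; decide) p
    rwa [lexWeight, if_neg hxy, nsmul_toLex, mul_zero, mul_one] at h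
  refine bind₁_ne_zero_of_isLeadingPart (w := lexWeight y)
    (v := ![toLex (m y, m x), toLex (0, p.natDegree), 0])
    (g := ![monomial m (coeff m G), C p.leadingCoeff * X x ^ p.natDegree, 0]) hP0 ?_
    (fun | 0 => hlead | 1 => hlead₁ | 2 => isLeadingPart_zero (zero_mem _)) fun i hi => ?_
  · intro a ha b hb hab
    have ha2 : a 2 = 0 := apply_eq_zero_of_mem_supported hP ha (by simp)
    have hb2 : b 2 = 0 := apply_eq_zero_of_mem_supported hP hb (by simp)
    simp only [weight_fin_three, Matrix.cons_val_zero, Matrix.cons_val_one, ha2, hb2, zero_nsmul,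
      add_zero, nsmul_toLex, ← toLex_add, toLex_inj, Prod.mk_add_mk, Prod.mk.injEq,
      mul_zero] at hab
    have h0 : a 0 = b 0 := Nat.eq_of_mul_eq_mul_right (Nat.pos_of_ne_zero hmy) hab.1
    have h1 : a 1 = b 1 :=
      Nat.eq_of_mul_eq_mul_right hp (Nat.add_left_cancel (h0 ▸ hab.2))
    exact Finsupp.ext fun | 0 => h0 | 1 => h1 | 2 => ha2.trans hb2.symm
  · match i with
    | 0 => exact monomial_eq_zero.not.2 hm0
    | 1 =>
      have hp0 : p ≠ 0 := Polynomial.ne_zero_of_natDegree_gt hp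
      exact mul_ne_zero (C_ne_zero.2 (Polynomial.leadingCoeff_ne_zero.2 hp0))
        (pow_ne_zero _ (X_ne_zero x))
    | 2 => exact absurd (mem_supported.1 hP hi) (by simp)

end Pair

section SubstExcept

variable {σ τ R : Type*} [CommRing R] [DecidableEq σ]

/-- The substitution `xₗ ↦ tₗ` for `l ≠ i`, with `xᵢ` kept as the variable of a univariate
polynomial. For `t = X` this views a polynomial as a polynomial in `xᵢ` alone. -/
noncomputable def substExcept (t : σ → MvPolynomial τ R) (i : σ) :
    MvPolynomial σ R →ₐ[R] Polynomial (MvPolynomial τ R) :=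
  aeval (Function.update (fun l => Polynomial.C (t l)) i Polynomial.X)

theorem substExcept_X_self (t : σ → MvPolynomial τ R) (i : σ) :
    substExcept t i (X i) = Polynomial.X := by
  simp [substExcept]

theorem substExcept_X_of_ne (t : σ → MvPolynomial τ R) {i l : σ} (hl : l ≠ i) :
    substExcept t i (X l) = Polynomial.C (t l) := by
  simp [substExcept, hl]

theorem substExcept_X_of_mem_supported {i : σ} {p : MvPolynomial σ R}
    (hp : p ∈ supported R {i}ᶜ) : substExcept X i p = Polynomial.C p := by
  refine hom_congr_vars (f₁ := (substExcept (R := R) X i).toRingHom) (f₂ := Polynomial.C)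
    (RingHom.ext (substExcept (R := R) X i).commutes) (fun l hl _ => ?_) rfl
  exact substExcept_X_of_ne X (mem_supported.1 hp hl)

theorem eval_substExcept (t : σ → MvPolynomial τ R) (i : σ) (p : MvPolynomial σ R)
    (y : MvPolynomial τ R) : (substExcept t i p).eval y = bind₁ (Function.update t i y) p := by
  have : ((Polynomial.aeval y).restrictScalars R).comp (substExcept t i) =
      bind₁ (Function.update t i y) := by
    ext1 l
    rw [AlgHom.comp_apply, bind₁_X_right]
    rcases eq_or_ne l i with rfl | hl
    · simp [substExcept_X_self]
    · simp [substExcept_X_of_ne, hl]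
  exact DFunLike.congr_fun this p

theorem substExcept_bind₁ {t : σ → MvPolynomial σ R} {i : σ}
    (ht : ∀ l ≠ i, t l ∈ supported R {i}ᶜ) (p : MvPolynomial σ R) :
    substExcept X i (bind₁ t p) = (substExcept t i p).comp (substExcept X i (t i)) := by
  have : (substExcept X i).comp (bind₁ t) =
      ((Polynomial.aeval (substExcept X i (t i))).restrictScalars R).comp (substExcept t i) := by
    ext1 l
    rw [AlgHom.comp_apply, bind₁_X_right]
    rcases eq_or_ne l i with rfl | hl
    · simp [substExcept_X_self]
    · rw [substExcept_X_of_mem_supported (ht l hl)]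
      simp [substExcept_X_of_ne, hl]
  exact DFunLike.congr_fun this p

variable [IsDomain R] {t : σ → MvPolynomial σ R} {i j : σ} {P Q : MvPolynomial σ R}

theorem natDegree_mul_natDegree_substExcept_eq_one (ht : ∀ l ≠ i, t l ∈ supported R {i}ᶜ)
    (hP : bind₁ t P = X i) :
    (substExcept t i P).natDegree * (substExcept X i (t i)).natDegree = 1 := by
  rw [← Polynomial.natDegree_comp, ← substExcept_bind₁ ht, hP, substExcept_X_self,
    Polynomial.natDegree_X]

theorem natDegree_substExcept_eq_one (ht : ∀ l ≠ i, t l ∈ supported R {i}ᶜ)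
    (hP : bind₁ t P = X i) : (substExcept X i (t i)).natDegree = 1 :=
  Nat.eq_one_of_mul_eq_one_left (natDegree_mul_natDegree_substExcept_eq_one ht hP)

theorem isUnit_leadingCoeff_substExcept (ht : ∀ l ≠ i, t l ∈ supported R {i}ᶜ)
    (hP : bind₁ t P = X i) : IsUnit (substExcept X i (t i)).leadingCoeff := by
  have h := congrArg Polynomial.leadingCoeff (substExcept_bind₁ ht P)
  rw [hP, substExcept_X_self, Polynomial.leadingCoeff_X, Polynomial.leadingCoeff_comp
    (by rw [natDegree_substExcept_eq_one ht hP]; exact one_ne_zero),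
    Nat.eq_one_of_mul_eq_one_right (natDegree_mul_natDegree_substExcept_eq_one ht hP),
    pow_one] at h
  exact .of_mul_eq_one_right _ h.symm

omit [DecidableEq σ] in
theorem exists_affine_of_bind₁_eq_X (ht : ∀ l ≠ i, t l ∈ supported R {i}ᶜ)
    (hP : bind₁ t P = X i) :
    ∃ a : R, IsUnit a ∧ ∃ b ∈ supported R {i}ᶜ, t i = C a * X i + b := by
  classical
  obtain ⟨a, ha, ha'⟩ := isUnit_iff_eq_C_of_isReduced.1 (isUnit_leadingCoeff_substExcept ht hP)
  refine ⟨a, ha, (substExcept X i (t i)).coeff 0, ?_, ?_⟩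
  · rw [Polynomial.coeff_zero_eq_eval_zero, eval_substExcept]
    refine bind₁_mem_supported (s := Set.univ) (fun l _ => ?_) (by simp [supported_univ])
    rcases eq_or_ne l i with rfl | hl
    · simp
    · simp [hl]
  · rw [Polynomial.leadingCoeff, natDegree_substExcept_eq_one ht hP] at ha'
    have h := eval_substExcept X i (t i) (X i)
    rwa [Function.update_eq_self, bind₁_X_left, AlgHom.id_apply, Polynomial.eval_eq_sum_range,
      natDegree_substExcept_eq_one ht hP, Finset.sum_range_succ, Finset.sum_range_one, pow_zero,
      mul_one, pow_one, ha', add_comm, eq_comm] at h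

theorem bind₁_update_zero_eq_X (ht : ∀ l ≠ i, t l ∈ supported R {i}ᶜ)
    (hP : bind₁ t P = X i) (hj : j ≠ i) (hQ : bind₁ t Q = X j) :
    bind₁ (Function.update t i 0) Q = X j := by
  have hcomp := substExcept_bind₁ ht Q
  rw [hQ, substExcept_X_of_ne X hj] at hcomp
  have hdeg := congrArg Polynomial.natDegree hcomp
  rw [Polynomial.natDegree_C, Polynomial.natDegree_comp, natDegree_substExcept_eq_one ht hP,
    mul_one] at hdeg
  rw [Polynomial.eq_C_of_natDegree_eq_zero hdeg.symm, Polynomial.C_comp, Polynomial.C_inj,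
    Polynomial.coeff_zero_eq_eval_zero, eval_substExcept] at hcomp
  exact hcomp.symm

end SubstExcept

section Bruhat

variable {K : Type*} [Field K] {n : ℕ}

/-- The Schur complement of the entry `A 0 j`: what remains of `A` once column `j` has been
cleared with row `0`. -/
def schurComplement (A : Matrix (Fin (n + 1)) (Fin (n + 1)) K) (j : Fin (n + 1)) :
    Matrix (Fin n) (Fin n) K :=
  .of fun i l => A i.succ (j.succAbove l) - A i.succ j / A 0 j * A 0 (j.succAbove l)

theorem det_schurComplement_ne_zero {A : Matrix (Fin (n + 1)) (Fin (n + 1)) K} (hA : A.det ≠ 0)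
    {j : Fin (n + 1)} (hj : A 0 j ≠ 0) : (schurComplement A j).det ≠ 0 := by
  intro h
  obtain ⟨v, hv0, hv⟩ := Matrix.exists_vecMul_eq_zero_iff.2 h
  refine hA (Matrix.exists_vecMul_eq_zero_iff.1
    ⟨Fin.cons (-∑ i, v i * (A i.succ j / A 0 j)) v, fun h0 => hv0 (funext fun i => ?_), ?_⟩)
  · exact congrFun h0 i.succ
  · funext l
    rw [Matrix.vecMul, dotProduct, Fin.sum_univ_succ, Fin.cons_zero]
    simp only [Fin.cons_succ, Pi.zero_apply]
    rw [neg_mul, Finset.sum_mul, neg_add_eq_zero, eq_comm, ← sub_eq_zero,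
      ← Finset.sum_sub_distrib]
    obtain rfl | ⟨l, rfl⟩ := Fin.eq_self_or_eq_succAbove j l
    · exact Finset.sum_eq_zero fun i _ => by field_simp; ring
    · refine (Finset.sum_congr rfl fun i _ => ?_).trans (congrFun hv l)
      rw [mul_assoc, ← mul_sub]
      rfl

theorem exists_ne_zero_and_forall_lt_eq_zero {α R : Type*} [Finite α] [LinearOrder α] [Zero R]
    {v : α → R} (hv : v ≠ 0) : ∃ j, v j ≠ 0 ∧ ∀ l, j < l → v l = 0 := by
  obtain ⟨j, hj⟩ := (Set.toFinite {l | v l ≠ 0}).exists_maximal (Function.ne_iff.1 hv)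
  exact ⟨j, hj.prop, fun l hl => by_contra fun h => hj.not_prop_of_gt hl h⟩

/-- The permutation with `0 ↦ j` that acts on the complements of `0` and `j` as `σ`. -/
def insertPerm (j : Fin (n + 1)) (σ : Equiv.Perm (Fin n)) : Equiv.Perm (Fin (n + 1)) :=
  ((finSuccEquiv' 0).trans (Equiv.optionCongr σ)).trans (finSuccEquiv' j).symm

theorem insertPerm_zero (j : Fin (n + 1)) (σ : Equiv.Perm (Fin n)) : insertPerm j σ 0 = j := by
  simp [insertPerm]

theorem insertPerm_succ (j : Fin (n + 1)) (σ : Equiv.Perm (Fin n)) (i : Fin n) :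
    insertPerm j σ i.succ = j.succAbove (σ i) := by
  rw [insertPerm, ← Fin.succAbove_zero]
  simp only [Equiv.trans_apply, finSuccEquiv'_succAbove, Equiv.optionCongr_apply, Option.map_some,
    finSuccEquiv'_symm_some]

theorem isLowerTriangular_cons {R : Type*} [Zero R] {B : Matrix (Fin n) (Fin n) R}
    (hB : B.IsLowerTriangular) (a : R) (c : Fin n → R) :
    (Matrix.of (Fin.cons (Fin.cons a 0) fun i => Fin.cons (c i) (B i)) :
      Matrix (Fin (n + 1)) (Fin (n + 1)) R).IsLowerTriangular := by
  intro i l hil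
  rw [OrderDual.toDual_lt_toDual] at hil
  cases l using Fin.cases with
  | zero => exact absurd hil (Fin.not_lt_zero i)
  | succ l =>
    cases i using Fin.cases with
    | zero => rfl
    | succ i => exact hB (OrderDual.toDual_lt_toDual.2 (Fin.succ_lt_succ_iff.1 hil))

theorem isLowerTriangular_insertNth {R : Type*} [Zero R] {C : Matrix (Fin n) (Fin n) R}
    (hC : C.IsLowerTriangular) {j : Fin (n + 1)} {v : Fin (n + 1) → R}
    (hv : ∀ l, j < l → v l = 0) :
    (Matrix.of (j.insertNth v fun i => j.insertNth 0 (C i)) :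
      Matrix (Fin (n + 1)) (Fin (n + 1)) R).IsLowerTriangular := by
  intro i l hil
  rw [OrderDual.toDual_lt_toDual] at hil
  rw [Matrix.of_apply]
  obtain rfl | ⟨i, rfl⟩ := Fin.eq_self_or_eq_succAbove j i
  · rw [Fin.insertNth_apply_same]
    exact hv l hil
  · rw [Fin.insertNth_apply_succAbove]
    obtain rfl | ⟨l, rfl⟩ := Fin.eq_self_or_eq_succAbove j l
    · rw [Fin.insertNth_apply_same]
    · rw [Fin.insertNth_apply_succAbove]
      exact hC (OrderDual.toDual_lt_toDual.2 (Fin.succAbove_lt_succAbove_iff.1 hil))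

theorem exists_bruhat_decomposition (A : Matrix (Fin n) (Fin n) K) (hA : A.det ≠ 0) :
    ∃ (B C : Matrix (Fin n) (Fin n) K) (σ : Equiv.Perm (Fin n)),
      B.IsLowerTriangular ∧ (∀ i, B i i = 1) ∧
      C.IsLowerTriangular ∧ A = B * C.submatrix σ id := by
  induction n with
  | zero => exact ⟨1, A, 1, fun i => i.elim0, fun i => i.elim0, fun i => i.elim0,
      Matrix.ext fun i => i.elim0⟩
  | succ n ih =>
    obtain ⟨j, hj, hjl⟩ := exists_ne_zero_and_forall_lt_eq_zero (v := A 0) fun h =>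
      hA (Matrix.det_eq_zero_of_row_eq_zero 0 (congrFun h))
    obtain ⟨B, C, σ, hB, hB1, hC, hA'⟩ := ih _ (det_schurComplement_ne_zero hA hj)
    refine ⟨.of (Fin.cons (Fin.cons 1 0) fun i => Fin.cons (A i.succ j / A 0 j) (B i)),
      .of (j.insertNth (A 0) fun i => j.insertNth 0 (C i)), insertPerm j σ,
      isLowerTriangular_cons hB _ _, Fin.cases rfl hB1, isLowerTriangular_insertNth hC hjl,
      Matrix.ext fun i l => ?_⟩
    rw [Matrix.mul_apply, Fin.sum_univ_succ]
    simp only [Matrix.submatrix_apply, insertPerm_zero, insertPerm_succ, Matrix.of_apply,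
      Fin.insertNth_apply_same, Fin.insertNth_apply_succAbove, id]
    cases i using Fin.cases with
    | zero => simp
    | succ i =>
      obtain rfl | ⟨l, rfl⟩ := Fin.eq_self_or_eq_succAbove j l
      · simp [hj]
      · simp only [Fin.cons_succ, Fin.cons_zero, Fin.insertNth_apply_succAbove]
        have := congrFun (congrFun hA' i) l
        rw [schurComplement, Matrix.mul_apply, Matrix.of_apply, sub_eq_iff_eq_add'] at this
        exact this

end Bruhat

section AffineForms

variable {σ R : Type*} [CommSemiring R]

theorem exists_eq_single_of_degree_eq_one {m : σ →₀ ℕ} (h : m.degree = 1) :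
    ∃ j, m = Finsupp.single j 1 := by
  obtain ⟨j, hj⟩ := Finsupp.ne_iff.1 (show m ≠ 0 by rintro rfl; simp at h)
  have hle : Finsupp.single j 1 ≤ m := Finsupp.single_le_iff.2 (Nat.one_le_iff_ne_zero.2 hj)
  rw [← tsub_add_cancel_of_le hle, map_add, Finsupp.degree_single, Nat.add_eq_right,
    Finsupp.degree_eq_zero_iff] at h
  exact ⟨j, le_antisymm (tsub_eq_zero_iff_le.1 h) hle⟩

theorem coeff_sum_C_mul_X [Fintype σ] (v : σ → R) (j : σ) :
    coeff (Finsupp.single j 1) (∑ i, C (v i) * X i) = v j := by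
  classical simp [coeff_sum, coeff_X, Finsupp.single_left_inj]

theorem eq_sum_C_mul_X_add_C_of_totalDegree_le_one [Fintype σ] {p : MvPolynomial σ R}
    (hp : p.totalDegree ≤ 1) :
    p = (∑ j, C (coeff (Finsupp.single j 1) p) * X j) + C (coeff 0 p) := by
  classical
  ext m
  rw [coeff_add]
  rcases eq_or_ne m 0 with rfl | hm
  · simp [coeff_sum]
  rw [coeff_C, if_neg hm.symm, add_zero]
  by_cases hm1 : m.degree = 1
  · obtain ⟨j, rfl⟩ := exists_eq_single_of_degree_eq_one hm1
    rw [coeff_sum_C_mul_X]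
  · have hlt : 1 < m.degree :=
      lt_of_le_of_ne' (Nat.one_le_iff_ne_zero.2 (mt (Finsupp.degree_eq_zero_iff m).1 hm)) hm1
    rw [coeff_eq_zero_of_totalDegree_lt (hp.trans_lt hlt), coeff_sum, Finset.sum_eq_zero]
    rintro j -
    rw [coeff_C_mul, coeff_X, if_neg (by rintro rfl; simp at hm1), mul_zero]

theorem eq_zero_of_sum_C_mul_X_eq_C [Fintype σ] {v : σ → R} {c : R}
    (h : ∑ i, C (v i) * X i = (C c : MvPolynomial σ R)) : v = 0 := by
  classical
  funext j
  rw [← coeff_sum_C_mul_X v j, h, coeff_C, if_neg (Finsupp.single_ne_zero.2 one_ne_zero).symm]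
  rfl

end AffineForms

section TotalDegree

variable {σ R M : Type*} [CommRing R] [AddCommMonoid M] [PartialOrder M] [IsOrderedAddMonoid M]
  {w : σ → M} {a D : M} {p G : MvPolynomial σ R}

theorem totalDegree_nsmul_le_of_mem_weightSubmodule (hp : p ∈ weightSubmodule R w (Set.Iic D))
    (hw : ∀ i, a ≤ w i) (hD : 0 ≤ D) : p.totalDegree • a ≤ D := by
  rcases eq_or_ne p 0 with rfl | h0
  · rwa [totalDegree_zero, zero_nsmul]
  obtain ⟨m, hm, hmp⟩ :=
    Finset.exists_mem_eq_sup _ (support_nonempty.2 h0) fun m => m.sum fun _ e => e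
  rw [totalDegree, hmp, Finsupp.sum, ← Finset.sum_nsmul_assoc]
  exact (Finset.sum_le_sum fun i _ => nsmul_le_nsmul_right (hw i) (m i)).trans
    (mem_weightSubmodule_iff.1 hp m hm)

theorem IsLeadingPart.le_totalDegree_nsmul (h : IsLeadingPart w D p G) (hG : G ≠ 0)
    (hw : ∀ i, w i ≤ a) (ha : 0 ≤ a) : D ≤ p.totalDegree • a := by
  obtain ⟨m, hm, -, rfl⟩ := h.exists_mem_support hG
  refine le_trans ?_ (nsmul_le_nsmul_left ha (le_totalDegree hm))
  rw [Finsupp.sum, ← Finset.sum_nsmul_assoc]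
  exact Finset.sum_le_sum fun i _ => nsmul_le_nsmul_right (hw i) (m i)

theorem mem_weightSubmodule_Iic_totalDegree_nsmul {s : Set σ} (hp : p ∈ supported R s)
    (hw : ∀ i ∈ s, w i ≤ a) (ha : 0 ≤ a) :
    p ∈ weightSubmodule R w (Set.Iic (p.totalDegree • a)) := by
  refine mem_weightSubmodule_iff.2 fun m hm => ?_
  refine le_trans ?_ (nsmul_le_nsmul_left ha (le_totalDegree hm))
  rw [Finsupp.weight_apply, Finsupp.sum, Finsupp.sum, ← Finset.sum_nsmul_assoc]
  exact Finset.sum_le_sum fun i hi => nsmul_le_nsmul_right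
    (hw i (mem_supported.1 hp ((mem_vars_iff_mem_support i).2 ⟨m, hm, hi⟩))) (m i)

end TotalDegree

theorem apply_add_apply_le_totalDegree {R : Type*} [CommSemiring R] {q : MvPolynomial (Fin 3) R}
    {m : Fin 3 →₀ ℕ} (hm : m ∈ q.support) : m 0 + m 1 ≤ q.totalDegree := by
  refine le_trans ?_ (le_totalDegree hm)
  rw [Finsupp.sum_fintype _ _ fun _ => rfl, Fin.sum_univ_three]
  exact Nat.le_add_right _ _

theorem natDegree_le_totalDegree_aeval_X {σ R : Type*} [CommRing R] [IsDomain R] (i : σ)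
    (p : Polynomial R) :
    p.natDegree ≤ (Polynomial.aeval (X i : MvPolynomial σ R) p).totalDegree := by
  rcases eq_or_ne p 0 with rfl | hp
  · exact Nat.zero_le _
  have h := ((isLeadingPart_X (w := fun _ => (1 : ℕ)) i).aeval one_pos p).le_totalDegree_nsmul
    (mul_ne_zero (C_ne_zero.2 (Polynomial.leadingCoeff_ne_zero.2 hp))
      (pow_ne_zero _ (X_ne_zero i))) (fun _ => le_rfl) zero_le_one
  simpa only [smul_eq_mul, mul_one] using h

theorem totalDegree_aeval_X_le {σ R : Type*} [CommRing R] (i : σ) (p : Polynomial R) :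
    (Polynomial.aeval (X i : MvPolynomial σ R) p).totalDegree ≤ p.natDegree := by
  have h := aeval_mem_weightSubmodule (w := fun _ : σ => 1) (R := R)
    (X_mem_weightSubmodule (i := i) Set.self_mem_Iic) zero_le_one p
  simpa using
    totalDegree_nsmul_le_of_mem_weightSubmodule h (a := 1) (fun _ => le_rfl) (by positivity)

theorem totalDegree_le_max_one_totalDegree_C_mul_X_add {σ R : Type*} [CommRing R] (e : R) (i : σ)
    (p : MvPolynomial σ R) : p.totalDegree ≤ max 1 (C e * X i + p).totalDegree := by
  nth_rw 1 [← add_sub_cancel_left (C e * X i) p]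
  refine (totalDegree_sub _ _).trans (max_comm 1 _ ▸ max_le_max_left _ ?_)
  rw [C_mul_X_eq_monomial]
  exact (totalDegree_monomial_le _ _).trans (by simp)

/-- The nonnegative root of `t ^ 2 = a * t + b * c`. -/
noncomputable def quadraticRoot (a b c : ℕ) : ℝ :=
  ((a : ℝ) + √((a : ℝ) ^ 2 + 4 * (b : ℝ) * (c : ℝ))) / 2

theorem quadraticRoot_sq (a b c : ℕ) :
    quadraticRoot a b c ^ 2 = a * quadraticRoot a b c + b * c := by
  have h := Real.sq_sqrt (show (0 : ℝ) ≤ (a : ℝ) ^ 2 + 4 * (b : ℝ) * (c : ℝ) by positivity)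
  unfold quadraticRoot
  linear_combination h / 4

theorem natCast_le_quadraticRoot (a b c : ℕ) : (a : ℝ) ≤ quadraticRoot a b c := by
  have h : (a : ℝ) ≤ √((a : ℝ) ^ 2 + 4 * (b : ℝ) * (c : ℝ)) :=
    Real.le_sqrt_of_sq_le (le_add_of_nonneg_right (by positivity))
  unfold quadraticRoot
  linarith

theorem quadraticRoot_zero_right (a b : ℕ) : quadraticRoot a b 0 = a := by
  unfold quadraticRoot
  rw [Nat.cast_zero, mul_zero, add_zero, Real.sqrt_sq a.cast_nonneg, add_self_div_two]

theorem quadraticRoot_mul_one (a b c : ℕ) : quadraticRoot a (b * c) 1 = quadraticRoot a b c := by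
  unfold quadraticRoot
  rw [Nat.cast_one, mul_one, Nat.cast_mul, ← mul_assoc]

theorem eq_quadraticRoot {a b c : ℕ} {θ : ℝ} (hθ : 0 < θ) (h : a * θ + b * c = θ ^ 2) :
    θ = quadraticRoot a b c := by
  have hbc : (0 : ℝ) ≤ b * c := by positivity
  have haθ : (a : ℝ) ≤ θ := by
    by_contra! hlt
    nlinarith
  have hs : √((a : ℝ) ^ 2 + 4 * (b : ℝ) * (c : ℝ)) = 2 * θ - a := by
    rw [show (a : ℝ) ^ 2 + 4 * (b : ℝ) * (c : ℝ) = (2 * θ - a) ^ 2 by linear_combination 4 * h]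
    exact Real.sqrt_sq (by linarith)
  unfold quadraticRoot
  rw [hs]
  ring

theorem le_sq_of_quadraticRoot_le {a b c : ℕ} {t : ℝ} (h : quadraticRoot a b c ≤ t) :
    a * t + b * c ≤ t ^ 2 := by
  have hsq := quadraticRoot_sq a b c
  have hle := natCast_le_quadraticRoot a b c
  nlinarith [mul_nonneg (sub_nonneg.2 h) (by linarith : (0 : ℝ) ≤ t + quadraticRoot a b c - a)]

theorem one_le_quadraticRoot {a b c : ℕ} (h : quadraticRoot a b c ≠ 0) :
    1 ≤ quadraticRoot a b c := by
  have hsq := quadraticRoot_sq a b c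
  have hle := natCast_le_quadraticRoot a b c
  rcases a.eq_zero_or_pos with rfl | ha
  · rw [Nat.cast_zero] at hle
    rw [Nat.cast_zero, zero_mul, zero_add, ← Nat.cast_mul] at hsq
    have hbc : b * c ≠ 0 := fun h0 => by simp [h0, h] at hsq
    have : (1 : ℝ) ≤ (b * c : ℕ) := by exact_mod_cast Nat.one_le_iff_ne_zero.2 hbc
    nlinarith
  · exact le_trans (by exact_mod_cast ha) hle

theorem exists_max_quadraticRoot {ι : Type*} (s : Finset ι) (a b : ι → ℕ) (c : ℕ) :
    ∃ θ : ℝ, 1 ≤ θ ∧ (∀ i ∈ s, a i * θ + b i * c ≤ θ ^ 2) ∧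
      (θ = 1 ∨ ∃ i ∈ s, a i * θ + b i * c = θ ^ 2) := by
  rcases s.eq_empty_or_nonempty with rfl | hs
  · exact ⟨1, le_rfl, by simp, Or.inl rfl⟩
  obtain ⟨i, hi, hmax⟩ := s.exists_max_image (fun i => quadraticRoot (a i) (b i) c) hs
  refine ⟨max 1 (quadraticRoot (a i) (b i) c), le_max_left _ _, fun j hj =>
    le_sq_of_quadraticRoot_le ((hmax j hj).trans (le_max_right _ _)), ?_⟩
  rcases max_choice 1 (quadraticRoot (a i) (b i) c) with h | h
  · exact Or.inl h
  · rw [h]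
    exact Or.inr ⟨i, hi, (quadraticRoot_sq _ _ _).symm⟩

/-- The numbers of the theorem: the roots of `t ^ 2 = a * t + b * c` with coefficients bounded by
the degree `d`. -/
def IsQuadraticOfDegreeLE (d : ℕ) (l : ℝ) : Prop :=
  ∃ a b c : ℕ, a + b ≤ d ∧ c ≤ d ∧ l = quadraticRoot a b c

theorem isQuadraticOfDegreeLE_of_eq_sq {a b c d : ℕ} {θ : ℝ} (hθ : 0 < θ) (hab : a + b ≤ d)
    (hc : c ≤ d) (h : a * θ + b * c = θ ^ 2) : IsQuadraticOfDegreeLE d θ :=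
  ⟨a, b, c, hab, hc, eq_quadraticRoot hθ h⟩

theorem isQuadraticOfDegreeLE_natCast {d M : ℕ} (hM : 0 < M) (h : M ≤ d) :
    IsQuadraticOfDegreeLE d M :=
  isQuadraticOfDegreeLE_of_eq_sq (b := 0) (c := 0) (Nat.cast_pos.2 hM) h d.zero_le (by ring)

theorem isQuadraticOfDegreeLE_one {d : ℕ} (hd : 1 ≤ d) : IsQuadraticOfDegreeLE d 1 := by
  exact_mod_cast isQuadraticOfDegreeLE_natCast one_pos hd

namespace PolyEnd

variable {k : Type*} [Field k] {n : ℕ}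

theorem coord_mul (f g : PolyEnd k n) (i : Fin n) :
    (f * g).coord i = bind₁ g.coord (f.coord i) := rfl

theorem coord_one (i : Fin n) : (1 : PolyEnd k n).coord i = X i := rfl

section DynamicalDegree

theorem tendsto_const_rpow_inv {c : ℝ} (hc : 0 < c) :
    Filter.Tendsto (fun r : ℕ => c ^ (1 / (r : ℝ))) Filter.atTop (nhds 1) := by
  have h := tendsto_const_div_atTop_nhds_zero_nat (1 : ℝ)
  simpa [Function.comp_def] using (Real.continuous_const_rpow hc.ne').tendsto 0 |>.comp h

theorem tendsto_mul_pow_rpow_inv {c θ : ℝ} (hc : 0 < c) (hθ : 0 ≤ θ) :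
    Filter.Tendsto (fun r : ℕ => (c * θ ^ r) ^ (1 / (r : ℝ))) Filter.atTop (nhds θ) := by
  have h := (tendsto_const_rpow_inv hc).mul_const θ
  rw [one_mul] at h
  refine h.congr' ?_
  filter_upwards [Filter.eventually_ne_atTop 0] with r hr
  rw [Real.mul_rpow hc.le (pow_nonneg hθ r), one_div, Real.pow_rpow_inv_natCast hθ hr]

theorem dynamicalDegree_le_of_degree_le (hn : 0 < n) {f : PolyEnd k n} (hf : IsUnit f)
    {c θ : ℝ} (hc : 0 < c) (hθ : 0 ≤ θ) (h : ∀ r, ((f ^ r).degree : ℝ) ≤ c * θ ^ r) :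
    f.dynamicalDegree ≤ θ :=
  le_of_tendsto_of_tendsto' (tendsto_dynamicalDegree hn hf) (tendsto_mul_pow_rpow_inv hc hθ)
    fun r => Real.rpow_le_rpow (Nat.cast_nonneg _) (h r) (by positivity)

theorem le_dynamicalDegree_of_le_degree (hn : 0 < n) {f : PolyEnd k n} (hf : IsUnit f)
    {c θ : ℝ} (hc : 0 < c) (hθ : 0 ≤ θ) (h : ∀ r, c * θ ^ r ≤ ((f ^ r).degree : ℝ)) :
    θ ≤ f.dynamicalDegree :=
  le_of_tendsto_of_tendsto' (tendsto_mul_pow_rpow_inv hc hθ) (tendsto_dynamicalDegree hn hf)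
    fun r => Real.rpow_le_rpow (by positivity) (h r) (by positivity)

theorem one_le_dynamicalDegree (hn : 0 < n) {f : PolyEnd k n} (hf : IsUnit f) :
    1 ≤ f.dynamicalDegree := by
  refine le_dynamicalDegree_of_le_degree hn hf one_pos zero_le_one fun r => ?_
  rw [one_pow, one_mul]
  exact_mod_cast one_le_degree hn (hf.pow r)

theorem dynamicalDegree_units_conj_le (hn : 0 < n) {f : PolyEnd k n} (hf : IsUnit f)
    (u : (PolyEnd k n)ˣ) : (↑u * f * ↑u⁻¹).dynamicalDegree ≤ f.dynamicalDegree := by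
  have hdeg (r : ℕ) : ((↑u * f * ↑u⁻¹) ^ r).degree ≤
      (u : PolyEnd k n).degree * (↑u⁻¹ : PolyEnd k n).degree * (f ^ r).degree := by
    rw [Units.conj_pow, mul_right_comm (Units.val u).degree]
    exact (degree_mul_le _ _).trans (Nat.mul_le_mul_right _ (degree_mul_le _ _))
  have hc : (0 : ℝ) < (u : PolyEnd k n).degree * (↑u⁻¹ : PolyEnd k n).degree := by
    exact_mod_cast Nat.mul_pos (one_le_degree hn u.isUnit) (one_le_degree hn u⁻¹.isUnit)
  have h := (tendsto_const_rpow_inv hc).mul (tendsto_dynamicalDegree hn hf)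
  rw [one_mul] at h
  refine le_of_tendsto_of_tendsto'
    (tendsto_dynamicalDegree hn ((u.isUnit.mul hf).mul u⁻¹.isUnit)) h fun r => ?_
  rw [← Real.mul_rpow hc.le (Nat.cast_nonneg _)]
  exact Real.rpow_le_rpow (Nat.cast_nonneg _) (by exact_mod_cast hdeg r) (by positivity)

theorem dynamicalDegree_units_conj (hn : 0 < n) {f : PolyEnd k n} (hf : IsUnit f)
    (u : (PolyEnd k n)ˣ) : (↑u * f * ↑u⁻¹).dynamicalDegree = f.dynamicalDegree := by
  refine le_antisymm (dynamicalDegree_units_conj_le hn hf u) ?_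
  have h := dynamicalDegree_units_conj_le hn ((u.isUnit.mul hf).mul u⁻¹.isUnit) u⁻¹
  have hu : ↑u⁻¹ * (↑u * f * ↑u⁻¹) * ↑u⁻¹⁻¹ = f := by
    rw [inv_inv, mul_assoc (u : PolyEnd k n), Units.inv_mul_cancel_left,
      Units.inv_mul_cancel_right]
  rwa [hu] at h

theorem coord_pow_mem_weightSubmodule {f : PolyEnd k n} {w : Fin n → ℝ} {θ : ℝ} (hθ : 0 ≤ θ)
    (h : ∀ i, f.coord i ∈ weightSubmodule k w (Set.Iic (θ * w i))) (r : ℕ) (i : Fin n) :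
    (f ^ r).coord i ∈ weightSubmodule k w (Set.Iic (θ ^ r * w i)) := by
  induction r generalizing i with
  | zero =>
    rw [pow_zero, pow_zero, one_mul]
    exact X_mem_weightSubmodule Set.self_mem_Iic
  | succ r ih =>
    rw [pow_succ' f, coord_mul, pow_succ, mul_assoc]
    exact bind₁_mem_weightSubmodule (mem_weightSubmodule_Iic_comp
      (φ := AddMonoidHom.mulLeft (θ ^ r)) (monotone_mul_left_of_nonneg (pow_nonneg hθ r)) (h i))
      (isLowerSet_Iic _) fun j _ => ih j

theorem isLeadingPart_coord_pow {f g : PolyEnd k n} {w : Fin n → ℝ} {θ : ℝ} (hθ : 0 < θ)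
    (h : ∀ i, IsLeadingPart w (θ * w i) (f.coord i) (g.coord i)) (r : ℕ) (i : Fin n) :
    IsLeadingPart w (θ ^ r * w i) ((f ^ r).coord i) ((g ^ r).coord i) := by
  induction r generalizing i with
  | zero =>
    rw [pow_zero, pow_zero, pow_zero, one_mul]
    exact isLeadingPart_X i
  | succ r ih =>
    rw [pow_succ' f, pow_succ' g, coord_mul, coord_mul, pow_succ, mul_assoc]
    exact ((h i).comp (φ := AddMonoidHom.mulLeft (θ ^ r))
      (strictMono_mul_left_of_pos (pow_pos hθ r))).bind₁ ih

theorem dynamicalDegree_le_of_mem_weightSubmodule (hn : 0 < n) {f : PolyEnd k n} (hf : IsUnit f)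
    {w : Fin n → ℝ} {θ : ℝ} (hw : ∀ i, 0 < w i) (hθ : 0 ≤ θ)
    (h : ∀ i, f.coord i ∈ weightSubmodule k w (Set.Iic (θ * w i))) : f.dynamicalDegree ≤ θ := by
  have : Nonempty (Fin n) := ⟨⟨0, hn⟩⟩
  obtain ⟨i₀, hi₀⟩ := Finite.exists_min w
  obtain ⟨i₁, hi₁⟩ := Finite.exists_max w
  refine dynamicalDegree_le_of_degree_le hn hf (div_pos (hw i₁) (hw i₀)) hθ fun r => ?_
  obtain ⟨i, -, hi⟩ := Finset.exists_mem_eq_sup (Finset.univ : Finset (Fin n))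
    Finset.univ_nonempty fun i => ((f ^ r).coord i).totalDegree
  rw [degree, hi, div_mul_eq_mul_div, le_div_iff₀ (hw i₀), ← nsmul_eq_mul, mul_comm (w i₁)]
  exact (totalDegree_nsmul_le_of_mem_weightSubmodule (coord_pow_mem_weightSubmodule hθ h r i) hi₀
    (mul_nonneg (pow_nonneg hθ r) (hw i).le)).trans
    (mul_le_mul_of_nonneg_left (hi₁ i) (pow_nonneg hθ r))

theorem le_dynamicalDegree_of_isLeadingPart (hn : 0 < n) {f g : PolyEnd k n} (hf : IsUnit f)
    {w : Fin n → ℝ} {θ : ℝ} (hθ : 0 < θ)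
    (h : ∀ i, IsLeadingPart w (θ * w i) (f.coord i) (g.coord i)) {i : Fin n} (hi : 0 < w i)
    (hg : ∀ r, (g ^ r).coord i ≠ 0) : θ ≤ f.dynamicalDegree := by
  have : Nonempty (Fin n) := ⟨⟨0, hn⟩⟩
  obtain ⟨i₁, hi₁⟩ := Finite.exists_max w
  have hpos : 0 < w i₁ := hi.trans_le (hi₁ i)
  refine le_dynamicalDegree_of_le_degree hn hf (div_pos hi hpos) hθ.le fun r => ?_
  rw [div_mul_eq_mul_div, div_le_iff₀ hpos, mul_comm (w i), ← nsmul_eq_mul]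
  exact ((isLeadingPart_coord_pow hθ h r i).le_totalDegree_nsmul (hg r) hi₁ hpos.le).trans
    (nsmul_le_nsmul_left hpos.le (totalDegree_coord_le _ i))

end DynamicalDegree

section LeadingMaps

theorem coord_pow_mem_supported {g : PolyEnd k n} {s : Set (Fin n)}
    (hg : ∀ i ∈ s, g.coord i ∈ supported k s) (r : ℕ) {i : Fin n} (hi : i ∈ s) :
    (g ^ r).coord i ∈ supported k s := by
  induction r with
  | zero => exact X_mem_supported.2 hi
  | succ r ih =>
    rw [pow_succ, coord_mul]
    exact bind₁_mem_supported hg ih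

theorem coord_pow_ne_zero {g : PolyEnd k n} {s : Set (Fin n)}
    (hg : ∀ i ∈ s, g.coord i ∈ supported k s)
    (h : ∀ P ∈ supported k s, P ≠ 0 → bind₁ g.coord P ≠ 0) (r : ℕ) {i : Fin n} (hi : i ∈ s) :
    (g ^ r).coord i ≠ 0 := by
  induction r with
  | zero => exact X_ne_zero i
  | succ r ih =>
    rw [pow_succ, coord_mul]
    exact h _ (coord_pow_mem_supported hg r hi) ih

theorem coord_zero_pow_ne_zero_of_mem_vars {g : PolyEnd k 3} {x y : Fin 3} (hxy : x ≠ y)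
    (hs : Set.Iio 2 = ({x, y} : Set (Fin 3))) (h0 : g.coord 0 ∈ supported k (Set.Iio 2))
    (hy : y ∈ (g.coord 0).vars)
    {p : Polynomial k} (h1 : g.coord 1 = Polynomial.aeval (X x) p) (hp : 1 ≤ p.natDegree)
    (h2 : g.coord 2 = 0) (r : ℕ) : (g ^ r).coord 0 ≠ 0 := by
  have hg : g.coord = ![g.coord 0, Polynomial.aeval (X x) p, 0] :=
    funext fun | 0 => rfl | 1 => h1 | 2 => h2
  refine coord_pow_ne_zero (s := Set.Iio 2) ?_ (fun P hP hP0 => ?_) r (by simp)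
  · rintro i hi
    match i with
    | 0 => exact h0
    | 1 => exact h1 ▸ aeval_X_mem_supported (by simp [hs]) p
    | 2 => exact absurd hi (by simp)
  · rw [hg]
    exact bind₁_pair_ne_zero hxy (hs ▸ h0) hy hp hP hP0

end LeadingMaps

section NonconstantSecondCoordinate

variable {f : PolyEnd k 3} {e η : k} {Q : MvPolynomial (Fin 3) k} {p : Polynomial k} {θ : ℝ}

theorem dynamicalDegree_le_of_natDegree_pos (hf : IsUnit f) (h0 : f.coord 0 = C e * X 2 + Q)
    (h1 : f.coord 1 = C η * X 1 + Polynomial.aeval (X 0) p) (hp : 1 ≤ p.natDegree) (hθ : 1 ≤ θ)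
    (hQ : Q ∈ weightSubmodule k ![θ, p.natDegree, θ] (Set.Iic (θ ^ 2)))
    (h2 : f.coord 2 ∈ weightSubmodule k ![θ, p.natDegree, θ] (Set.Iic θ)) :
    f.dynamicalDegree ≤ θ := by
  have hθ0 : 0 < θ := by linarith
  have hc : (1 : ℝ) ≤ p.natDegree := by exact_mod_cast hp
  refine dynamicalDegree_le_of_mem_weightSubmodule three_pos hf
    (w := ![θ, p.natDegree, θ]) (fun | 0 => hθ0 | 1 => one_pos.trans_le hc | 2 => hθ0) hθ0.le
    fun | 0 => ?_ | 1 => ?_ | 2 => ?_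
  · simp only [Matrix.cons_val_zero, ← pow_two]
    rw [h0]
    refine add_mem (C_mul_X_mem_weightSubmodule ?_ e) hQ
    exact show θ ≤ θ ^ 2 from le_self_pow₀ hθ two_ne_zero
  · have hp' := aeval_mem_weightSubmodule (w := ![θ, (p.natDegree : ℝ), θ]) (R := k)
      (X_mem_weightSubmodule (i := 0) Set.self_mem_Iic) hθ0.le p
    rw [nsmul_eq_mul, mul_comm] at hp'
    rw [h1]
    refine add_mem (C_mul_X_mem_weightSubmodule ?_ η) hp'
    exact show (p.natDegree : ℝ) ≤ θ * p.natDegree from le_mul_of_one_le_left (Nat.cast_nonneg _) hθ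
  · exact weightSubmodule_mono (Set.Iic_subset_Iic.2
      (show θ ≤ θ * θ from le_mul_of_one_le_left hθ0.le hθ)) h2

theorem le_dynamicalDegree_of_natDegree_pos (hf : IsUnit f) (h0 : f.coord 0 = C e * X 2 + Q)
    (hQs : Q ∈ supported k (Set.Iio 2))
    (h1 : f.coord 1 = C η * X 1 + Polynomial.aeval (X 0) p) (hp : 1 ≤ p.natDegree) (hθ : 1 < θ)
    (hQ : Q ∈ weightSubmodule k ![θ, p.natDegree, θ] (Set.Iic (θ ^ 2)))
    (hQθ : ∃ m ∈ Q.support, Finsupp.weight ![θ, (p.natDegree : ℝ), θ] m = θ ^ 2)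
    (h2 : f.coord 2 ∈ weightSubmodule k ![θ, p.natDegree, θ] (Set.Iic θ)) :
    θ ≤ f.dynamicalDegree := by
  have hθ0 : 0 < θ := by linarith
  have hc : (1 : ℝ) ≤ p.natDegree := by exact_mod_cast hp
  set w : Fin 3 → ℝ := ![θ, p.natDegree, θ]
  obtain ⟨m, hm, hmθ⟩ := hQθ
  have hG := isLeadingPart_weightedHomogeneousComponent hQ
  have hGs := weightedHomogeneousComponent_mem_supported hQs w (θ ^ 2)
  set G := weightedHomogeneousComponent w (θ ^ 2) Q
  have hG0 : G ≠ 0 := ne_zero_iff.2 ⟨m, hG.coeff_eq hmθ ▸ mem_support_iff.1 hm⟩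
  let q : Polynomial k := Polynomial.monomial p.natDegree p.leadingCoeff
  have hq : q.natDegree = p.natDegree := Polynomial.natDegree_monomial_eq _ <|
    Polynomial.leadingCoeff_ne_zero.2 (Polynomial.ne_zero_of_natDegree_gt hp)
  let g : PolyEnd k 3 := ⟨![G, Polynomial.aeval (X 0) q, 0]⟩
  refine le_dynamicalDegree_of_isLeadingPart three_pos hf hθ0 (w := w) (g := g) (i := 0)
    (fun | 0 => ?_ | 1 => ?_ | 2 => ?_) hθ0 fun r => ?_
  · rw [h0, add_comm, show θ * w 0 = θ ^ 2 from (pow_two θ).symm]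
    refine hG.add_of_lt (C_mul_X_mem_weightSubmodule ?_ e)
    exact show θ < θ ^ 2 from lt_self_pow₀ hθ one_lt_two
  · have hp' := (isLeadingPart_X (R := k) (w := w) 0).aeval hθ0 p
    have hq' : g.coord 1 = C p.leadingCoeff * X 0 ^ p.natDegree := Polynomial.aeval_monomial _
    rw [h1, add_comm, hq', mul_comm θ, show w 1 = p.natDegree from rfl, ← nsmul_eq_mul]
    refine hp'.add_of_lt (C_mul_X_mem_weightSubmodule (Set.mem_Iio.2 ?_) η)
    rw [nsmul_eq_mul]
    exact lt_mul_of_one_lt_right (one_pos.trans_le hc) hθ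
  · exact isLeadingPart_zero (weightSubmodule_mono
      (Set.Iic_subset_Iio.2 (show θ < θ * θ from lt_mul_of_one_lt_left hθ0 hθ)) h2)
  · by_cases h1G : 1 ∈ G.vars
    · exact coord_zero_pow_ne_zero_of_mem_vars (g := g) (p := q) zero_ne_one
        Iio_two_fin_three hGs h1G rfl (hp.trans_eq hq.symm) rfl r
    · have hGs0 : G ∈ supported k {0} := mem_supported.2 fun i hi => by
        have hi2 : i ∈ ({0, 1} : Set (Fin 3)) := Iio_two_fin_three ▸ mem_supported.1 hGs hi
        exact hi2.resolve_right fun h => h1G (h ▸ hi)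
      refine coord_pow_ne_zero (g := g) (s := {0}) (by rintro _ rfl; exact hGs0)
        (fun P hP => bind₁_ne_zero_of_isWeightedHomogeneous (w := w) (f := g.coord)
          (i := 0) ?_ (pow_pos hθ0 2) hG0 hP) r rfl
      exact hG.isWeightedHomogeneous

theorem dynamicalDegree_eq_of_natDegree_pos (hf : IsUnit f) (h0 : f.coord 0 = C e * X 2 + Q)
    (hQs : Q ∈ supported k (Set.Iio 2))
    (h1 : f.coord 1 = C η * X 1 + Polynomial.aeval (X 0) p) (hp : 1 ≤ p.natDegree)
    (h2 : f.coord 2 ∈ weightSubmodule k ![θ, p.natDegree, θ] (Set.Iic θ)) (hθ : 1 ≤ θ)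
    (hle : ∀ m ∈ Q.support, m 0 * θ + m 1 * p.natDegree ≤ θ ^ 2)
    (heq : θ = 1 ∨ ∃ m ∈ Q.support, m 0 * θ + m 1 * p.natDegree = θ ^ 2) :
    f.dynamicalDegree = θ := by
  have hQ : Q ∈ weightSubmodule k ![θ, p.natDegree, θ] (Set.Iic (θ ^ 2)) :=
    (mem_weightSubmodule_iff_of_mem_supported_Iio_two hQs).2 hle
  refine le_antisymm (dynamicalDegree_le_of_natDegree_pos hf h0 h1 hp hθ hQ h2) ?_
  rcases hθ.eq_or_lt with rfl | hθ1
  · exact one_le_dynamicalDegree three_pos hf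
  obtain ⟨m, hm, hmθ⟩ := heq.resolve_left hθ1.ne'
  refine le_dynamicalDegree_of_natDegree_pos hf h0 hQs h1 hp hθ1 hQ ⟨m, hm, ?_⟩ h2
  rw [weight_fin_three, apply_eq_zero_of_mem_supported hQs hm (i := 2) (by simp), ← hmθ]
  simp

end NonconstantSecondCoordinate

section AffineSecondCoordinate

variable {f : PolyEnd k 3} {e η ζ a : k} {Q : MvPolynomial (Fin 3) k} {p : Polynomial k}

theorem dynamicalDegree_le_add_of_affine (hf : IsUnit f) (h0 : f.coord 0 = C e * X 2 + Q)
    (hQs : Q ∈ supported k (Set.Iio 2)) (h1 : f.coord 1 = C η * X 1 + C ζ)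
    (h2 : f.coord 2 = C a * X 0 + Polynomial.aeval (X 1) p) {δ : ℝ} (hδ : 0 < δ) :
    f.dynamicalDegree ≤ (max 1 (Q.degreeOf 0) : ℕ) + (Q.degreeOf 1 + p.natDegree : ℕ) * δ := by
  set M : ℝ := ((max 1 (Q.degreeOf 0) : ℕ) : ℝ)
  set N : ℕ := Q.degreeOf 1 + p.natDegree
  have hM1 : 1 ≤ M := Nat.one_le_cast.2 (le_max_left _ _)
  have hNδ : 0 ≤ N * δ := by positivity
  have h1M : 1 ≤ (M + N * δ) * 1 := by linarith
  refine dynamicalDegree_le_of_mem_weightSubmodule three_pos hf (w := ![1, δ, 1])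
    (fun | 0 => one_pos | 1 => hδ | 2 => one_pos) (by linarith) fun | 0 => ?_ | 1 => ?_ | 2 => ?_
  · rw [h0]
    refine add_mem (C_mul_X_mem_weightSubmodule (w := ![1, δ, 1]) h1M e)
      ((mem_weightSubmodule_iff_of_mem_supported_Iio_two hQs).2 fun m hm => ?_)
    have e0 : (m 0 : ℝ) ≤ M :=
      Nat.cast_le.2 ((monomial_le_degreeOf 0 hm).trans (le_max_right _ _))
    have e1 : (m 1 : ℝ) ≤ N :=
      Nat.cast_le.2 ((monomial_le_degreeOf 1 hm).trans (Nat.le_add_right _ _))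
    exact show m 0 * 1 + m 1 * δ ≤ (M + N * δ) * 1 by nlinarith
  · rw [h1]
    refine add_mem (C_mul_X_mem_weightSubmodule ?_ η) (C_mem_weightSubmodule ?_ ζ)
    · exact show δ ≤ (M + N * δ) * δ from le_mul_of_one_le_left hδ.le (by linarith)
    · exact show 0 ≤ (M + N * δ) * δ by positivity
  · rw [h2]
    refine add_mem (C_mul_X_mem_weightSubmodule (w := ![1, δ, 1]) h1M a) (weightSubmodule_mono
      (Set.Iic_subset_Iic.2 ?_) (aeval_mem_weightSubmodule
        (X_mem_weightSubmodule (i := 1) Set.self_mem_Iic) hδ.le p))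
    have e2 : (p.natDegree : ℝ) ≤ N := Nat.cast_le.2 (Nat.le_add_left _ _)
    exact show p.natDegree • δ ≤ (M + N * δ) * 1 by rw [nsmul_eq_mul]; nlinarith

theorem exists_isLeadingPart_degreeOf_zero (hQs : Q ∈ supported k (Set.Iio 2))
    (hQ : Q.degreeOf 0 ≠ 0) : ∃ G ∈ supported k (Set.Iio 2), 0 ∈ G.vars ∧
      IsLeadingPart ![1, 0, 1] (Q.degreeOf 0 : ℝ) Q G := by
  have hwt {m} (hm : m ∈ Q.support) : Finsupp.weight ![1, 0, 1] m = (m 0 : ℝ) := by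
    rw [weight_fin_three, apply_eq_zero_of_mem_supported hQs hm (i := 2) (by simp)]
    simp
  have hG := isLeadingPart_weightedHomogeneousComponent (w := ![1, 0, 1]) (D := (Q.degreeOf 0 : ℝ))
    (p := Q) (mem_weightSubmodule_iff.2 fun m hm => by
      rw [hwt hm]
      exact Nat.cast_le (α := ℝ).2 (monomial_le_degreeOf 0 hm))
  refine ⟨_, weightedHomogeneousComponent_mem_supported hQs _ _, ?_, hG⟩
  obtain ⟨m, hm, hm0⟩ := exists_mem_support_apply_eq_degreeOf (p := Q)
    (fun h => hQ (by rw [h, degreeOf_zero])) 0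
  exact (mem_vars_iff_mem_support 0).2 ⟨m,
    mem_support_iff.2 (hG.coeff_eq (by rw [hwt hm, hm0]) ▸ mem_support_iff.1 hm),
    Finsupp.mem_support_iff.2 (hm0 ▸ hQ)⟩

theorem le_dynamicalDegree_of_affine (hf : IsUnit f) (hη : η ≠ 0)
    (h0 : f.coord 0 = C e * X 2 + Q) (hQs : Q ∈ supported k (Set.Iio 2))
    (h1 : f.coord 1 = C η * X 1 + C ζ) (h2 : f.coord 2 = C a * X 0 + Polynomial.aeval (X 1) p)
    (hQ1 : 1 < Q.degreeOf 0) : (Q.degreeOf 0 : ℝ) ≤ f.dynamicalDegree := by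
  obtain ⟨G, hGs, hG0, hG⟩ := exists_isLeadingPart_degreeOf_zero hQs (zero_lt_one.trans hQ1).ne'
  set M := Q.degreeOf 0
  have hM1 : (1 : ℝ) < M := by exact_mod_cast hQ1
  have hM0 : (0 : ℝ) < M := one_pos.trans hM1
  set w : Fin 3 → ℝ := ![1, 0, 1]
  let q : Polynomial k := Polynomial.C η * Polynomial.X + Polynomial.C ζ
  have hq : 1 ≤ q.natDegree := (Polynomial.natDegree_linear hη).ge
  have hq' : f.coord 1 = Polynomial.aeval (X 1) q := by rw [h1]; simp [q]
  let g : PolyEnd k 3 := ⟨![G, Polynomial.aeval (X 1) q, 0]⟩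
  refine le_dynamicalDegree_of_isLeadingPart three_pos hf hM0 (w := w) (g := g) (i := 0)
    (fun | 0 => ?_ | 1 => ?_ | 2 => isLeadingPart_zero ?_) one_pos
    (coord_zero_pow_ne_zero_of_mem_vars (g := g) (p := q) one_ne_zero
      (Iio_two_fin_three.trans (Set.pair_comm 0 1)) hGs hG0 rfl hq rfl)
  · rw [h0, add_comm, show (M : ℝ) * w 0 = M from mul_one _]
    refine hG.add_of_lt (C_mul_X_mem_weightSubmodule ?_ e)
    exact show 1 < (M : ℝ) from hM1
  · rw [show g.coord 1 = f.coord 1 from hq'.symm]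
    refine isLeadingPart_self ((isWeightedHomogeneous_iff_mem_weightSubmodule (M := ℝ)).2 ?_)
    rw [h1, show (M : ℝ) * w 1 = 0 from mul_zero _]
    refine add_mem (C_mul_X_mem_weightSubmodule ?_ η)
      (C_mem_weightSubmodule (Set.mem_singleton _) ζ)
    exact show w 1 = 0 from rfl
  · rw [h2, show (M : ℝ) * w 2 = M from mul_one _]
    refine add_mem (C_mul_X_mem_weightSubmodule ?_ a)
      (weightSubmodule_mono (Set.Iic_subset_Iio.2 hM0) ?_)
    · exact show 1 < (M : ℝ) from hM1
    · rw [← smul_zero p.natDegree]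
      exact aeval_mem_weightSubmodule (X_mem_weightSubmodule (i := 1) Set.self_mem_Iic) le_rfl p

theorem dynamicalDegree_eq_of_affine (hf : IsUnit f) (hη : η ≠ 0)
    (h0 : f.coord 0 = C e * X 2 + Q) (hQs : Q ∈ supported k (Set.Iio 2))
    (h1 : f.coord 1 = C η * X 1 + C ζ) (h2 : f.coord 2 = C a * X 0 + Polynomial.aeval (X 1) p) :
    f.dynamicalDegree = (max 1 (Q.degreeOf 0) : ℕ) := by
  refine le_antisymm (le_of_forall_pos_le_add fun ε hε => ?_) ?_
  · have hK : (0 : ℝ) < (Q.degreeOf 1 + p.natDegree : ℕ) + 1 := by positivity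
    refine (dynamicalDegree_le_add_of_affine hf h0 hQs h1 h2 (div_pos hε hK)).trans ?_
    gcongr
    rw [← mul_div_assoc, div_le_iff₀ hK]
    nlinarith
  · rcases le_or_gt (Q.degreeOf 0) 1 with h | h
    · rw [max_eq_left h, Nat.cast_one]
      exact one_le_dynamicalDegree three_pos hf
    · rw [max_eq_right h.le]
      exact le_dynamicalDegree_of_affine hf hη h0 hQs h1 h2 h

end AffineSecondCoordinate

section Triangular

theorem IsTriangular.mul {f g : PolyEnd k n} (hf : f.IsTriangular) (hg : g.IsTriangular) :
    (f * g).IsTriangular := by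
  intro i
  rw [coord_mul]
  exact bind₁_mem_supported
    (fun j hj => supported_mono (Set.Iic_subset_Iic.2 (Set.mem_Iic.1 hj)) (hg j)) (hf i)

/-- The first `m` coordinates of `τ`, followed by zeros. Comparing the truncations of a triangular
automorphism with its inverse determines its coordinates one at a time, from the last one down. -/
noncomputable def truncation (τ : PolyEnd k n) (m : ℕ) (l : Fin n) : MvPolynomial (Fin n) k :=
  if (l : ℕ) < m then τ.coord l else 0

theorem truncation_of_lt (τ : PolyEnd k n) {m : ℕ} {l : Fin n} (h : l < m) :
    truncation τ m l = τ.coord l :=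
  if_pos h

theorem update_truncation_succ (τ : PolyEnd k n) (i : Fin n) :
    Function.update (truncation τ (i + 1)) i 0 = truncation τ i := by
  funext l
  rcases eq_or_ne l i with rfl | hl
  · simp [truncation]
  · have : (l : ℕ) ≠ i := Fin.val_ne_of_ne hl
    simp only [truncation, Function.update_of_ne hl]
    exact if_congr (by omega) rfl rfl

theorem IsTriangular.truncation_succ_mem_supported {τ : PolyEnd k n} (hτ : τ.IsTriangular)
    {i l : Fin n} (hl : l ≠ i) : truncation τ (i + 1) l ∈ supported k {i}ᶜ := by
  rw [truncation]
  split_ifs with h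
  · have hli : l < i := lt_of_le_of_ne (Fin.le_def.2 (Nat.le_of_lt_succ h)) hl
    exact supported_mono (fun j hj => (lt_of_le_of_lt (Set.mem_Iic.1 hj) hli).ne) (hτ l)
  · exact zero_mem _

theorem IsTriangular.bind₁_truncation_eq_X {τ ρ : PolyEnd k n} (hτ : τ.IsTriangular)
    (h : ρ * τ = 1) {m : ℕ} (hm : m ≤ n) :
    ∀ j : Fin n, j < m → bind₁ (truncation τ m) (ρ.coord j) = X j := by
  induction hm using Nat.decreasingInduction with
  | self =>
    intro j _
    rw [show truncation τ n = τ.coord from funext fun l => truncation_of_lt τ l.isLt, ← coord_mul,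
      h, coord_one]
  | of_succ m hm ih =>
    intro j hj
    rw [← update_truncation_succ τ ⟨m, hm⟩]
    exact bind₁_update_zero_eq_X (fun l hl => hτ.truncation_succ_mem_supported hl)
      (ih ⟨m, hm⟩ (Nat.lt_succ_self m)) (Fin.ne_of_val_ne hj.ne)
      (ih j (hj.trans (Nat.lt_succ_self m)))

theorem IsTriangular.exists_coord_eq {τ : PolyEnd k n} (hτ : τ.IsTriangular) (hu : IsUnit τ)
    (i : Fin n) :
    ∃ a : k, a ≠ 0 ∧ ∃ b ∈ supported k (Set.Iio i), τ.coord i = C a * X i + b := by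
  obtain ⟨ρ, hρ⟩ := hu.exists_left_inv
  obtain ⟨a, ha, b, hb, h⟩ := exists_affine_of_bind₁_eq_X
    (fun l hl => hτ.truncation_succ_mem_supported hl)
    (hτ.bind₁_truncation_eq_X hρ i.isLt i (Nat.lt_succ_self i))
  rw [truncation_of_lt τ (Nat.lt_succ_self i)] at h
  have hb' : b ∈ supported k (Set.Iic i) := by
    rw [← sub_eq_iff_eq_add'.2 h]
    exact sub_mem (hτ i) (mul_mem (Subalgebra.algebraMap_mem _ a)
      (X_mem_supported.2 Set.self_mem_Iic))
  refine ⟨a, ha.ne_zero, b, mem_supported.2 fun l hl => ?_, h⟩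
  exact lt_of_le_of_ne (mem_supported.1 hb' hl) (mem_supported.1 hb hl)

theorem IsTriangular.exists_eq {τ : PolyEnd k 3} (hτ : τ.IsTriangular) (hu : IsUnit τ) :
    ∃ (a₀ a₁ a₂ b : k) (p : Polynomial k) (q : MvPolynomial (Fin 3) k),
      a₀ ≠ 0 ∧ a₁ ≠ 0 ∧ a₂ ≠ 0 ∧ q ∈ supported k (Set.Iio 2) ∧
      τ.coord 0 = C a₀ * X 0 + C b ∧ τ.coord 1 = C a₁ * X 1 + Polynomial.aeval (X 0) p ∧
      τ.coord 2 = C a₂ * X 2 + q := by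
  obtain ⟨a₀, ha₀, b, hb, h0⟩ := hτ.exists_coord_eq hu 0
  obtain ⟨a₁, ha₁, p, hp, h1⟩ := hτ.exists_coord_eq hu 1
  obtain ⟨a₂, ha₂, q, hq, h2⟩ := hτ.exists_coord_eq hu 2
  rw [show Set.Iio (0 : Fin 3) = ∅ from Set.Iio_bot, supported_empty] at hb
  obtain ⟨b, rfl⟩ := Algebra.mem_bot.1 hb
  rw [show Set.Iio (1 : Fin 3) = {0} from Set.ext fun l => Fin.lt_one_iff l] at hp
  obtain ⟨p, rfl⟩ := exists_eq_aeval_of_mem_supported_singleton hp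
  exact ⟨a₀, a₁, a₂, b, p, q, ha₀, ha₁, ha₂, hq, h0, h1, h2⟩

end Triangular

section Linear

theorem degree_mul_le_of_degree_le_one_left {f g : PolyEnd k n} (hf : f.degree ≤ 1) :
    (f * g).degree ≤ g.degree :=
  (degree_mul_le f g).trans ((Nat.mul_le_mul_right _ hf).trans_eq (one_mul _))

theorem degree_mul_le_of_degree_le_one_right {f g : PolyEnd k n} (hg : g.degree ≤ 1) :
    (f * g).degree ≤ f.degree :=
  (degree_mul_le f g).trans ((Nat.mul_le_mul_left _ hg).trans_eq (mul_one _))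

/-- The permutation of the coordinates by `σ`, as an automorphism of affine space. -/
noncomputable def ofPerm (k : Type*) [Field k] (σ : Equiv.Perm (Fin n)) : PolyEnd k n :=
  ⟨fun i => X (σ i)⟩

theorem coord_ofPerm_mul (σ : Equiv.Perm (Fin n)) (f : PolyEnd k n) (i : Fin n) :
    (ofPerm k σ * f).coord i = f.coord (σ i) := by
  rw [coord_mul]
  exact bind₁_X_right _ _

theorem ofPerm_inv_mul_cancel_left (σ : Equiv.Perm (Fin n)) (f : PolyEnd k n) :
    ofPerm k σ⁻¹ * (ofPerm k σ * f) = f := by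
  refine PolyEnd.ext (funext fun i => ?_)
  rw [coord_ofPerm_mul, coord_ofPerm_mul]
  exact congrArg f.coord (σ.apply_symm_apply i)

theorem isUnit_ofPerm (σ : Equiv.Perm (Fin n)) : IsUnit (ofPerm k σ) := by
  have h := ofPerm_inv_mul_cancel_left (k := k) σ 1
  have h' := ofPerm_inv_mul_cancel_left (k := k) σ⁻¹ 1
  rw [mul_one] at h h'
  rw [inv_inv] at h'
  exact ⟨⟨ofPerm k σ, ofPerm k σ⁻¹, h', h⟩, rfl⟩

theorem degree_ofPerm_le (σ : Equiv.Perm (Fin n)) : (ofPerm k σ).degree ≤ 1 :=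
  Finset.sup_le fun i _ => (totalDegree_X (R := k) (σ i)).le

theorem isAffineAut_ofPerm (hn : 0 < n) (σ : Equiv.Perm (Fin n)) : (ofPerm k σ).IsAffineAut :=
  ⟨isUnit_ofPerm σ, le_antisymm (degree_ofPerm_le σ) (one_le_degree hn (isUnit_ofPerm σ))⟩

/-- The linear endomorphism `x ↦ A x` given by a matrix `A`. -/
noncomputable def ofMatrix : Matrix (Fin n) (Fin n) k →* PolyEnd k n where
  toFun A := ⟨fun i => ∑ j, C (A i j) * X j⟩
  map_one' := by
    refine PolyEnd.ext (funext fun i => ?_)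
    simp [coord_one, Matrix.one_apply, ite_mul]
  map_mul' A B := by
    refine PolyEnd.ext (funext fun i => ?_)
    rw [coord_mul]
    simp only [map_sum, map_mul, bind₁_C_right, bind₁_X_right, Matrix.mul_apply,
      Finset.sum_mul, Finset.mul_sum, mul_assoc]
    exact Finset.sum_comm

theorem coord_ofMatrix (A : Matrix (Fin n) (Fin n) k) (i : Fin n) :
    (ofMatrix A).coord i = ∑ j, C (A i j) * X j := rfl

theorem ofMatrix_mul_submatrix (B D : Matrix (Fin n) (Fin n) k) (σ : Equiv.Perm (Fin n)) :
    ofMatrix (B * D.submatrix σ id) = ofMatrix B * (ofPerm k σ * ofMatrix D) := by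
  rw [map_mul]
  congr 1
  refine PolyEnd.ext (funext fun i => ?_)
  rw [coord_ofPerm_mul]
  rfl

theorem degree_ofMatrix_le (A : Matrix (Fin n) (Fin n) k) : (ofMatrix A).degree ≤ 1 := by
  refine Finset.sup_le fun i _ => totalDegree_finsetSum_le fun j _ => ?_
  refine (totalDegree_mul _ _).trans ?_
  rw [totalDegree_C, totalDegree_X]

theorem isTriangular_ofMatrix {A : Matrix (Fin n) (Fin n) k}
    (hA : A.IsLowerTriangular) : (ofMatrix A).IsTriangular := by
  intro i
  rw [coord_ofMatrix]
  refine sum_mem fun j _ => ?_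
  rcases le_or_gt j i with hij | hij
  · exact mul_mem (Subalgebra.algebraMap_mem _ _) (X_mem_supported.2 hij)
  · rw [hA (OrderDual.toDual_lt_toDual.2 hij), C_0, zero_mul]
    exact zero_mem _

end Linear

section Affine

theorem det_ne_zero_of_coord_eq {α : PolyEnd k n} (hα : IsUnit α) {A : Matrix (Fin n) (Fin n) k}
    {c : Fin n → k} (h : ∀ i, α.coord i = (∑ j, C (A i j) * X j) + C (c i)) : A.det ≠ 0 := by
  intro hA
  obtain ⟨v, hv, hvA⟩ := Matrix.exists_vecMul_eq_zero_iff.2 hA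
  have hconst : ∑ i, C (v i) * α.coord i = C (∑ i, v i * c i) := by
    calc ∑ i, C (v i) * α.coord i
        = (∑ j, C (Matrix.vecMul v A j) * X j) + C (∑ i, v i * c i) := by
          simp only [h, mul_add, Finset.mul_sum, Finset.sum_add_distrib, Matrix.vecMul,
            dotProduct, map_sum, map_mul, Finset.sum_mul, mul_assoc]
          rw [Finset.sum_comm]
      _ = C (∑ i, v i * c i) := by simp [hvA]
  obtain ⟨β, hβ⟩ := hα.exists_right_inv
  refine hv (eq_zero_of_sum_C_mul_X_eq_C (c := ∑ i, v i * c i) ?_)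
  have h' := congrArg (bind₁ β.coord) hconst
  simpa only [map_sum, map_mul, bind₁_C_right, ← coord_mul, hβ, coord_one] using h'

theorem IsAffineAut.exists_eq {α : PolyEnd k n} (hα : α.IsAffineAut) :
    ∃ (A : Matrix (Fin n) (Fin n) k) (t : PolyEnd k n),
      A.det ≠ 0 ∧ t.IsTriangular ∧ α = ofMatrix A * t := by
  let A : Matrix (Fin n) (Fin n) k := .of fun i j => coeff (Finsupp.single j 1) (α.coord i)
  let c : Fin n → k := fun i => coeff 0 (α.coord i)
  have hαA (i : Fin n) : α.coord i = (∑ j, C (A i j) * X j) + C (c i) :=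
    eq_sum_C_mul_X_add_C_of_totalDegree_le_one ((totalDegree_coord_le α i).trans hα.2.le)
  have hdet := det_ne_zero_of_coord_eq hα.1 hαA
  have hc : A.mulVec (A⁻¹.mulVec c) = c := by
    rw [Matrix.mulVec_mulVec, Matrix.mul_nonsing_inv _ hdet.isUnit, Matrix.one_mulVec]
  refine ⟨A, ⟨fun i => X i + C (A⁻¹.mulVec c i)⟩, hdet, fun i => ?_,
    PolyEnd.ext (funext fun i => ?_)⟩
  · exact add_mem (X_mem_supported.2 Set.self_mem_Iic) (Subalgebra.algebraMap_mem _ _)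
  · rw [coord_mul, hαA i, ← congrFun hc i, coord_ofMatrix]
    simp [mul_add, Finset.sum_add_distrib, Matrix.mulVec, dotProduct]

theorem IsAffineTriangular.exists_conj (hn : 0 < n) {f : PolyEnd k n} (hf : IsUnit f)
    (h : f.IsAffineTriangular) :
    ∃ (σ : Equiv.Perm (Fin n)) (τ : PolyEnd k n), τ.IsTriangular ∧ IsUnit τ ∧
      τ.degree ≤ f.degree ∧ f.dynamicalDegree = (ofPerm k σ * τ).dynamicalDegree := by
  obtain ⟨α, τ, hα, hτ, rfl⟩ := h
  obtain ⟨A, t, hA, ht, rfl⟩ := hα.exists_eq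
  obtain ⟨B, D, σ, hB, hB1, hD, rfl⟩ := exists_bruhat_decomposition A hA
  have hBu : IsUnit B.det := by simp [Matrix.det_of_isLowerTriangular B hB, hB1]
  let u : (PolyEnd k n)ˣ := Units.map ofMatrix (B.nonsingInvUnit hBu)
  have hu : (u : PolyEnd k n) = ofMatrix B := rfl
  let τ' := ofMatrix D * t * τ * u
  have hf' : ofMatrix (B * D.submatrix σ id) * t * τ = ↑u * (ofPerm k σ * τ') * ↑u⁻¹ := by
    rw [ofMatrix_mul_submatrix, ← hu]
    simp only [τ', mul_assoc, Units.mul_inv, mul_one]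
  rw [hf'] at hf ⊢
  have hστ : IsUnit (ofPerm k σ * τ') := by simpa using hf
  have hτ' : τ' = ofPerm k σ⁻¹ * (↑u⁻¹ * (↑u * (ofPerm k σ * τ') * ↑u⁻¹) * ↑u) := by
    simp only [mul_assoc, Units.inv_mul_cancel_left, Units.inv_mul, mul_one,
      ofPerm_inv_mul_cancel_left]
  refine ⟨σ, τ', ?_, ?_, ?_, dynamicalDegree_units_conj hn hστ u⟩
  · exact (((isTriangular_ofMatrix hD).mul ht).mul hτ).mul (isTriangular_ofMatrix hB)
  · rw [← ofPerm_inv_mul_cancel_left σ τ']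
    exact (isUnit_ofPerm σ⁻¹).mul hστ
  · conv_lhs => rw [hτ']
    exact (degree_mul_le_of_degree_le_one_left (degree_ofPerm_le _)).trans <|
      (degree_mul_le_of_degree_le_one_right (degree_ofMatrix_le B)).trans <|
      degree_mul_le_of_degree_le_one_left (degree_ofMatrix_le _)

end Affine

section Conjugation

theorem isUnit_of_semiconjBy {f f' h : PolyEnd k n} (hf : IsUnit f) (hh : IsUnit h)
    (e : SemiconjBy h f f') : IsUnit f' := by
  obtain ⟨u, rfl⟩ := hh
  exact (Units.isUnit_mul_units f' u).1 (e.eq ▸ u.isUnit.mul hf)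

theorem dynamicalDegree_eq_of_semiconjBy (hn : 0 < n) {f f' h : PolyEnd k n} (hf : IsUnit f)
    (hh : IsUnit h) (e : SemiconjBy h f f') : f'.dynamicalDegree = f.dynamicalDegree := by
  obtain ⟨u, rfl⟩ := hh
  rw [← dynamicalDegree_units_conj hn hf u, e.eq, Units.mul_inv_cancel_right]

end Conjugation

theorem IsTriangular.dynamicalDegree_eq_one (hn : 0 < n) {τ : PolyEnd k n} (hτ : τ.IsTriangular)
    (hu : IsUnit τ) : τ.dynamicalDegree = 1 := by
  refine le_antisymm ?_ (one_le_dynamicalDegree hn hu)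
  have hD : 1 ≤ τ.degree := one_le_degree hn hu
  have hD1 : (1 : ℝ) ≤ τ.degree := Nat.one_le_cast.2 hD
  refine dynamicalDegree_le_of_mem_weightSubmodule (w := fun i => (τ.degree : ℝ) ^ (i : ℕ)) hn hu
    (fun i => pow_pos (by linarith) _) zero_le_one fun i => ?_
  rw [one_mul]
  obtain ⟨a, -, b, hb, hi⟩ := hτ.exists_coord_eq hu i
  rw [hi]
  refine add_mem (C_mul_X_mem_weightSubmodule Set.self_mem_Iic a) ?_
  rcases hi0 : (i : ℕ) with _ | j
  · refine weightSubmodule_mono (Set.Iic_subset_Iic.2 ?_)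
      (mem_weightSubmodule_Iic_totalDegree_nsmul (a := 0) hb (fun l hl => ?_) le_rfl)
    · rw [nsmul_zero]
      exact pow_nonneg (by linarith) _
    · exact absurd (show (l : ℕ) < i from hl) (by omega)
  · refine weightSubmodule_mono (Set.Iic_subset_Iic.2 ?_)
      (mem_weightSubmodule_Iic_totalDegree_nsmul (a := (τ.degree : ℝ) ^ j) hb (fun l hl => ?_)
        (by positivity))
    · have hbD : b.totalDegree ≤ τ.degree :=
        (totalDegree_le_max_one_totalDegree_C_mul_X_add a i b).trans
          (max_le hD (hi ▸ totalDegree_coord_le τ i))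
      rw [nsmul_eq_mul, pow_succ']
      exact mul_le_mul_of_nonneg_right (Nat.cast_le.2 hbD) (by positivity)
    · have hli : (l : ℕ) < i := hl
      exact pow_le_pow_right₀ hD1 (by omega)

theorem coord_pow_ne_zero_of_eq_C_mul_X_pow {g : PolyEnd k n} {i : Fin n} {a : k} {c : ℕ}
    (ha : a ≠ 0) (hc : 0 < c) (hg : g.coord i = C a * X i ^ c) (r : ℕ) :
    (g ^ r).coord i ≠ 0 := by
  have hX := (isWeightedHomogeneous_C 1 a).mul ((isWeightedHomogeneous_X k (1 : Fin n → ℕ) i).pow c)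
  rw [← hg, Pi.one_apply, zero_add, smul_eq_mul, mul_one] at hX
  have h0 : g.coord i ≠ 0 := hg ▸ mul_ne_zero (C_ne_zero.2 ha) (pow_ne_zero c (X_ne_zero i))
  refine coord_pow_ne_zero (s := {i}) ?_ (fun P hP =>
    bind₁_ne_zero_of_isWeightedHomogeneous hX hc h0 hP) r (Set.mem_singleton i)
  rintro _ rfl
  rw [hg]
  exact mul_mem (Subalgebra.algebraMap_mem (supported k {_}) a)
    (pow_mem (X_mem_supported.2 (Set.mem_singleton _)) c)

section SwapZeroOne

variable {f : PolyEnd k 3} {a₀ a₁ a₂ b : k} {p : Polynomial k} {q : MvPolynomial (Fin 3) k}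

theorem mem_weightSubmodule_Iio_totalDegree_add_one {L : ℝ} (hq : q ∈ supported k (Set.Iio 2)) :
    q ∈ weightSubmodule k ![1, 1, L] (Set.Iio (q.totalDegree + 1)) := by
  refine weightSubmodule_mono (Set.Iic_subset_Iio.2 ?_)
    (mem_weightSubmodule_Iic_totalDegree_nsmul (a := 1) hq ?_ zero_le_one)
  · rw [nsmul_one]
    exact lt_add_one _
  · rw [Iio_two_fin_three]
    rintro i (rfl | rfl) <;> exact le_rfl

theorem dynamicalDegree_le_max_natDegree (hf : IsUnit f) (hq : q ∈ supported k (Set.Iio 2))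
    (h0 : f.coord 0 = C a₁ * X 1 + Polynomial.aeval (X 0) p) (h1 : f.coord 1 = C a₀ * X 0 + C b)
    (h2 : f.coord 2 = C a₂ * X 2 + q) : f.dynamicalDegree ≤ (max 1 p.natDegree : ℕ) := by
  set θ : ℝ := ((max 1 p.natDegree : ℕ) : ℝ)
  have hθ : 1 ≤ θ := Nat.one_le_cast.2 (le_max_left 1 p.natDegree)
  have hpθ : (p.natDegree : ℝ) ≤ θ := Nat.cast_le.2 (le_max_right 1 p.natDegree)
  set L : ℝ := q.totalDegree + 1
  have hL : 0 < L := by positivity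
  set w : Fin 3 → ℝ := ![1, 1, L]
  have hθL : L ≤ θ * L := le_mul_of_one_le_left hL.le hθ
  refine dynamicalDegree_le_of_mem_weightSubmodule three_pos hf (w := w)
    (fun | 0 => one_pos | 1 => one_pos | 2 => hL) (by linarith) fun | 0 => ?_ | 1 => ?_ | 2 => ?_
  · rw [h0, show θ * w 0 = θ from mul_one θ]
    have hp := aeval_mem_weightSubmodule (w := w) (R := k)
      (X_mem_weightSubmodule (i := 0) Set.self_mem_Iic) zero_le_one p
    rw [show w 0 = 1 from rfl, nsmul_one] at hp
    refine add_mem (C_mul_X_mem_weightSubmodule ?_ a₁)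
      (weightSubmodule_mono (Set.Iic_subset_Iic.2 hpθ) hp)
    exact show 1 ≤ θ from hθ
  · rw [h1, show θ * w 1 = θ from mul_one θ]
    refine add_mem (C_mul_X_mem_weightSubmodule ?_ a₀)
      (C_mem_weightSubmodule (Set.mem_Iic.2 (zero_le_one.trans hθ)) b)
    exact show 1 ≤ θ from hθ
  · rw [h2, show θ * w 2 = θ * L from rfl]
    refine add_mem (C_mul_X_mem_weightSubmodule ?_ a₂) (weightSubmodule_mono
      (Set.Iio_subset_Iic_self.trans (Set.Iic_subset_Iic.2 hθL))
      (mem_weightSubmodule_Iio_totalDegree_add_one hq))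
    exact show L ≤ θ * L from hθL

theorem natDegree_le_dynamicalDegree (hf : IsUnit f) (hq : q ∈ supported k (Set.Iio 2))
    (h0 : f.coord 0 = C a₁ * X 1 + Polynomial.aeval (X 0) p) (h1 : f.coord 1 = C a₀ * X 0 + C b)
    (h2 : f.coord 2 = C a₂ * X 2 + q) (hp : 1 < p.natDegree) :
    (p.natDegree : ℝ) ≤ f.dynamicalDegree := by
  set θ : ℝ := (p.natDegree : ℝ) with hθdef
  have hθ : 1 < θ := Nat.one_lt_cast.2 hp
  set L : ℝ := q.totalDegree + 1
  have hL : 0 < L := by positivity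
  set w : Fin 3 → ℝ := ![1, 1, L]
  have hθL : L < θ * L := lt_mul_of_one_lt_left hL hθ
  have hlc : p.leadingCoeff ≠ 0 :=
    Polynomial.leadingCoeff_ne_zero.2 (Polynomial.ne_zero_of_natDegree_gt hp)
  have hlead := (isLeadingPart_X (R := k) (w := w) 0).aeval one_pos p
  rw [show w 0 = 1 from rfl, nsmul_one, ← hθdef] at hlead
  let g : PolyEnd k 3 := ⟨![C p.leadingCoeff * X 0 ^ p.natDegree, 0, 0]⟩
  refine le_dynamicalDegree_of_isLeadingPart three_pos hf (by linarith) (w := w) (g := g) (i := 0)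
    (fun | 0 => ?_ | 1 => isLeadingPart_zero ?_ | 2 => isLeadingPart_zero ?_) one_pos
    (coord_pow_ne_zero_of_eq_C_mul_X_pow hlc (zero_lt_one.trans hp) rfl)
  · rw [h0, add_comm, show θ * w 0 = θ from mul_one θ]
    refine hlead.add_of_lt (C_mul_X_mem_weightSubmodule ?_ a₁)
    exact show 1 < θ from hθ
  · rw [h1, show θ * w 1 = θ from mul_one θ]
    refine add_mem (C_mul_X_mem_weightSubmodule ?_ a₀)
      (C_mem_weightSubmodule (Set.mem_Iio.2 (zero_lt_one.trans hθ)) b)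
    exact show 1 < θ from hθ
  · rw [h2, show θ * w 2 = θ * L from rfl]
    refine add_mem (C_mul_X_mem_weightSubmodule ?_ a₂) (weightSubmodule_mono
      (Set.Iio_subset_Iio hθL.le) (mem_weightSubmodule_Iio_totalDegree_add_one hq))
    exact show L < θ * L from hθL

theorem dynamicalDegree_eq_max_natDegree (hf : IsUnit f) (hq : q ∈ supported k (Set.Iio 2))
    (h0 : f.coord 0 = C a₁ * X 1 + Polynomial.aeval (X 0) p) (h1 : f.coord 1 = C a₀ * X 0 + C b)
    (h2 : f.coord 2 = C a₂ * X 2 + q) : f.dynamicalDegree = (max 1 p.natDegree : ℕ) := by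
  refine le_antisymm (dynamicalDegree_le_max_natDegree hf hq h0 h1 h2) ?_
  rcases le_or_gt p.natDegree 1 with hp | hp
  · rw [max_eq_left hp, Nat.cast_one]
    exact one_le_dynamicalDegree three_pos hf
  · rw [max_eq_right hp.le]
    exact natDegree_le_dynamicalDegree hf hq h0 h1 h2 hp

end SwapZeroOne

section MaxQuadraticRoot

/-- `θ` is the maximum of `1` and of the largest roots of `t ^ 2 = a * t + b * c`, for `(a, b)` in
the support of the polynomial `Q` in the first two variables. -/
structure IsMaxQuadraticRoot (Q : MvPolynomial (Fin 3) k) (c : ℕ) (θ : ℝ) : Prop where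
  one_le : 1 ≤ θ
  le_sq : ∀ m ∈ Q.support, m 0 * θ + m 1 * c ≤ θ ^ 2
  eq_one_or_eq_sq : θ = 1 ∨ ∃ m ∈ Q.support, m 0 * θ + m 1 * c = θ ^ 2

theorem IsMaxQuadraticRoot.isQuadraticOfDegreeLE {Q : MvPolynomial (Fin 3) k} {c d : ℕ} {θ : ℝ}
    (h : IsMaxQuadraticRoot Q c θ) (hd : 1 ≤ d) (hc : c ≤ d)
    (hQ : ∀ m ∈ Q.support, m 0 * θ + m 1 * c = θ ^ 2 → m 0 + m 1 ≤ d) :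
    IsQuadraticOfDegreeLE d θ := by
  rcases h.eq_one_or_eq_sq with rfl | ⟨m, hm, heq⟩
  · exact isQuadraticOfDegreeLE_one hd
  · exact isQuadraticOfDegreeLE_of_eq_sq (zero_lt_one.trans_le h.one_le) (hQ m hm heq) hc heq

variable {f : PolyEnd k 3} {a₀ a₁ a₂ b e : k} {p : Polynomial k} {q : MvPolynomial (Fin 3) k}

theorem isMaxQuadraticRoot_dynamicalDegree (hf : IsUnit f) (hq : q ∈ supported k (Set.Iio 2))
    (h0 : f.coord 0 = C a₂ * X 2 + q) (h1 : f.coord 1 = C a₁ * X 1 + Polynomial.aeval (X 0) p)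
    (h2 : ∀ θ : ℝ, 1 ≤ θ → f.coord 2 ∈ weightSubmodule k ![θ, p.natDegree, θ] (Set.Iic θ))
    (hp : 1 ≤ p.natDegree) : IsMaxQuadraticRoot q p.natDegree f.dynamicalDegree := by
  obtain ⟨θ, hθ, hle, heq⟩ := exists_max_quadraticRoot q.support (· 0) (· 1) p.natDegree
  rw [dynamicalDegree_eq_of_natDegree_pos hf h0 hq h1 hp (h2 θ hθ) hθ hle heq]
  exact ⟨hθ, hle, heq⟩

theorem isMaxQuadraticRoot_dynamicalDegree_of_shift (hf : IsUnit f) (ha₀ : a₀ ≠ 0)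
    (hq : q ∈ supported k (Set.Iio 2)) (h0 : f.coord 0 = C a₂ * X 2 + q)
    (h1 : f.coord 1 = C a₀ * X 0 + C b) (h2 : f.coord 2 = C a₁ * X 1 + C e) :
    IsMaxQuadraticRoot q 1 f.dynamicalDegree := by
  have hp : (Polynomial.C a₀ * Polynomial.X + Polynomial.C b).natDegree = 1 :=
    Polynomial.natDegree_linear ha₀
  have h1' : f.coord 1 = C 0 * X 1 +
      Polynomial.aeval (X 0) (Polynomial.C a₀ * Polynomial.X + Polynomial.C b) := by
    rw [h1, C_0, zero_mul, zero_add, map_add, map_mul, Polynomial.aeval_C, Polynomial.aeval_C,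
      Polynomial.aeval_X, algebraMap_eq]
  rw [← hp]
  refine isMaxQuadraticRoot_dynamicalDegree hf hq h0 h1' (fun θ hθ => ?_) hp.ge
  rw [h2, hp, Nat.cast_one]
  refine add_mem (C_mul_X_mem_weightSubmodule ?_ a₁)
    (C_mem_weightSubmodule (Set.mem_Iic.2 (zero_le_one.trans hθ)) e)
  exact show 1 ≤ θ from hθ

end MaxQuadraticRoot

section PermutedTriangular

variable {f : PolyEnd k 3} {a₀ a₁ a₂ b : k} {p : Polynomial k} {q : MvPolynomial (Fin 3) k} {d : ℕ}

theorem isQuadraticOfDegreeLE_of_affine (hf : IsUnit f) (hd : 1 ≤ d) (ha₁ : a₁ ≠ 0)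
    (hqs : q ∈ supported k (Set.Iio 2)) (hq : q.totalDegree ≤ d) (h0 : f.coord 0 = C a₂ * X 2 + q)
    (h1 : f.coord 1 = C a₁ * X 1 + C b) (h2 : f.coord 2 = C a₀ * X 0 + Polynomial.aeval (X 1) p) :
    IsQuadraticOfDegreeLE d f.dynamicalDegree := by
  rw [dynamicalDegree_eq_of_affine hf ha₁ h0 hqs h1 h2]
  exact isQuadraticOfDegreeLE_natCast (one_pos.trans_le (le_max_left _ _))
    (max_le hd ((degreeOf_le_totalDegree q 0).trans hq))

theorem isQuadraticOfDegreeLE_of_swap_zero_two (hf : IsUnit f) (hd : 1 ≤ d) (ha₁ : a₁ ≠ 0)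
    (hqs : q ∈ supported k (Set.Iio 2)) (hp : p.natDegree ≤ d) (hq : q.totalDegree ≤ d)
    (h0 : f.coord 0 = C a₂ * X 2 + q) (h1 : f.coord 1 = C a₁ * X 1 + Polynomial.aeval (X 0) p)
    (h2 : f.coord 2 = C a₀ * X 0 + C b) : IsQuadraticOfDegreeLE d f.dynamicalDegree := by
  rcases Nat.eq_zero_or_pos p.natDegree with hp0 | hp0
  · obtain ⟨e, rfl⟩ := Polynomial.natDegree_eq_zero.1 hp0
    rw [Polynomial.aeval_C] at h1
    refine isQuadraticOfDegreeLE_of_affine (a₀ := a₀) (p := Polynomial.C b)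
      hf hd ha₁ hqs hq h0 h1 ?_
    rw [h2, Polynomial.aeval_C, algebraMap_eq]
  · refine (isMaxQuadraticRoot_dynamicalDegree hf hqs h0 h1 (fun θ hθ => ?_) hp0)
      |>.isQuadraticOfDegreeLE hd hp fun m hm _ => (apply_add_apply_le_totalDegree hm).trans hq
    rw [h2]
    refine add_mem (C_mul_X_mem_weightSubmodule ?_ a₀)
      (C_mem_weightSubmodule (Set.mem_Iic.2 (zero_le_one.trans hθ)) b)
    exact show θ ≤ θ from le_rfl

theorem bind₁_coord_ofPerm (σ : Equiv.Perm (Fin n)) (q : MvPolynomial (Fin n) k) :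
    bind₁ (ofPerm k σ).coord q = rename σ q :=
  DFunLike.congr_fun (algHom_ext (g := rename σ) fun i => by rw [bind₁_X_right, rename_X]; rfl) q

theorem semiconjBy_ofPerm (σ : Equiv.Perm (Fin n)) (f : PolyEnd k n) :
    SemiconjBy (ofPerm k σ) f ⟨fun i => rename σ.symm (f.coord (σ i))⟩ := by
  refine PolyEnd.ext (funext fun i => ?_)
  rw [coord_ofPerm_mul, coord_mul, bind₁_coord_ofPerm, rename_rename, Equiv.self_comp_symm,
    rename_id_apply]

theorem isQuadraticOfDegreeLE_of_swap_one_two (hf : IsUnit f) (hd : 1 ≤ d) (ha₀ : a₀ ≠ 0)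
    (hqs : q ∈ supported k (Set.Iio 2)) (hq : q.totalDegree ≤ d)
    (h0 : f.coord 0 = C a₀ * X 0 + C b) (h1 : f.coord 1 = C a₂ * X 2 + q)
    (h2 : f.coord 2 = C a₁ * X 1 + Polynomial.aeval (X 0) p) :
    IsQuadraticOfDegreeLE d f.dynamicalDegree := by
  let σ : Equiv.Perm (Fin 3) := Equiv.swap 0 1
  have e := semiconjBy_ofPerm σ f
  have hσq : rename σ q ∈ supported k (Set.Iio 2) := by
    rw [← bind₁_coord_ofPerm]
    refine bind₁_mem_supported (fun i hi => X_mem_supported.2 ?_) hqs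
    rw [Iio_two_fin_three] at hi ⊢
    exact hi.elim (fun h => Or.inr (h ▸ rfl)) fun h => Or.inl (h ▸ rfl)
  rw [← dynamicalDegree_eq_of_semiconjBy three_pos hf (isUnit_ofPerm σ) e]
  refine isQuadraticOfDegreeLE_of_affine (q := rename σ q) (a₂ := a₂) (b := b) (a₀ := a₁) (p := p)
    (isUnit_of_semiconjBy hf (isUnit_ofPerm σ) e) hd ha₀ hσq
    ((totalDegree_rename_le σ q).trans hq) ?_ ?_ ?_
  · change rename σ (f.coord 1) = _
    rw [h1, map_add, map_mul, rename_C, rename_X]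
    rfl
  · change rename σ (f.coord 0) = _
    rw [h0, map_add, map_mul, rename_C, rename_C, rename_X]
    rfl
  · change rename σ (f.coord 2) = _
    rw [h2, map_add, map_mul, rename_C, rename_X, ← Polynomial.aeval_algHom_apply, rename_X]
    rfl

end PermutedTriangular

section RotateInv

/-- The endomorphism adding `b` to the `i`-th coordinate, an elementary automorphism when `b` does
not involve `X i`. -/
noncomputable def elementary (i : Fin n) (b : MvPolynomial (Fin n) k) : PolyEnd k n :=
  ⟨Function.update X i (X i + b)⟩

theorem coord_elementary_self (i : Fin n) (b : MvPolynomial (Fin n) k) :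
    (elementary i b).coord i = X i + b :=
  Function.update_self ..

theorem coord_elementary_of_ne {i j : Fin n} (h : j ≠ i) (b : MvPolynomial (Fin n) k) :
    (elementary i b).coord j = X j :=
  Function.update_of_ne h ..

theorem bind₁_coord_elementary_of_mem_supported {i : Fin n} {b p : MvPolynomial (Fin n) k}
    (hp : p ∈ supported k {i}ᶜ) : bind₁ (elementary i b).coord p = p :=
  bind₁_eq_self_of_mem_supported (fun _ hj => coord_elementary_of_ne hj b) hp

theorem elementary_mul_elementary_neg {i : Fin n} {b : MvPolynomial (Fin n) k}
    (hb : b ∈ supported k {i}ᶜ) : elementary i b * elementary i (-b) = 1 := by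
  refine PolyEnd.ext (funext fun j => ?_)
  rw [coord_mul, coord_one]
  rcases eq_or_ne j i with rfl | hj
  · rw [coord_elementary_self, map_add, bind₁_X_right, coord_elementary_self,
      bind₁_coord_elementary_of_mem_supported hb, neg_add_cancel_right]
  · rw [coord_elementary_of_ne hj, bind₁_X_right, coord_elementary_of_ne hj]

theorem isUnit_elementary {i : Fin n} {b : MvPolynomial (Fin n) k} (hb : b ∈ supported k {i}ᶜ) :
    IsUnit (elementary i b) := by
  have h := elementary_mul_elementary_neg (neg_mem hb)
  rw [neg_neg] at h
  exact ⟨⟨_, _, elementary_mul_elementary_neg hb, h⟩, rfl⟩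

variable {f : PolyEnd k 3} {a₀ a₁ a₂ b : k} {p : Polynomial k} {q : MvPolynomial (Fin 3) k} {d : ℕ}

theorem semiconjBy_elementary {P : MvPolynomial (Fin 3) k}
    (hqs : q ∈ supported k {2}ᶜ) (hPs : P ∈ supported k {2}ᶜ) (h0 : f.coord 0 = C a₂ * X 2 + q)
    (h1 : f.coord 1 = C a₀ * X 0 + C b) (h2 : f.coord 2 = C a₁ * X 1 + bind₁ f.coord P) :
    SemiconjBy (elementary 2 (-P)) f
      ⟨![C a₂ * X 2 + (q + C a₂ * P), C a₀ * X 0 + C b, C a₁ * X 1]⟩ := by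
  refine PolyEnd.ext (funext fun i => ?_)
  rw [coord_mul, coord_mul]
  match i with
  | 0 =>
    rw [coord_elementary_of_ne (by decide), bind₁_X_right, h0]
    change _ = bind₁ (elementary 2 (-P)).coord (C a₂ * X 2 + (q + C a₂ * P))
    rw [map_add, map_add, map_mul, map_mul, bind₁_C_right, bind₁_X_right, coord_elementary_self,
      bind₁_coord_elementary_of_mem_supported hqs, bind₁_coord_elementary_of_mem_supported hPs]
    ring
  | 1 =>
    rw [coord_elementary_of_ne (by decide), bind₁_X_right, h1]
    change _ = bind₁ (elementary 2 (-P)).coord (C a₀ * X 0 + C b)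
    rw [map_add, map_mul, bind₁_C_right, bind₁_C_right, bind₁_X_right,
      coord_elementary_of_ne (by decide)]
  | 2 =>
    rw [coord_elementary_self, map_add, map_neg, bind₁_X_right, h2, add_neg_cancel_right]
    change _ = bind₁ (elementary 2 (-P)).coord (C a₁ * X 1)
    rw [map_mul, bind₁_C_right, bind₁_X_right, coord_elementary_of_ne (by decide)]

theorem isQuadraticOfDegreeLE_of_rotate_inv (hf : IsUnit f) (hd : 1 ≤ d) (ha₀ : a₀ ≠ 0)
    (hqs : q ∈ supported k (Set.Iio 2)) (hp : p.natDegree ≤ d) (hq : q.totalDegree ≤ d)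
    (h0 : f.coord 0 = C a₂ * X 2 + q) (h1 : f.coord 1 = C a₀ * X 0 + C b)
    (h2 : f.coord 2 = C a₁ * X 1 + Polynomial.aeval (X 0) p) :
    IsQuadraticOfDegreeLE d f.dynamicalDegree := by
  let l : Polynomial k := Polynomial.C a₀⁻¹ * (Polynomial.X - Polynomial.C b)
  let P : MvPolynomial (Fin 3) k := Polynomial.aeval (X 1) (p.comp l)
  have hl : Polynomial.aeval (f.coord 1) l = X 0 := by
    rw [map_mul, map_sub, Polynomial.aeval_C, Polynomial.aeval_C, Polynomial.aeval_X, h1,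
      algebraMap_eq, add_sub_cancel_right, ← mul_assoc, ← C_mul, inv_mul_cancel₀ ha₀, C_1, one_mul]
  have hPf : bind₁ f.coord P = Polynomial.aeval (X 0) p := by
    rw [bind₁_aeval, bind₁_X_right, Polynomial.aeval_comp, hl]
  have hlow : (supported k (Set.Iio 2) : Subalgebra k (MvPolynomial (Fin 3) k)) ≤
      supported k {2}ᶜ := supported_mono fun i hi => ne_of_lt hi
  have hPs : P ∈ supported k (Set.Iio 2) := aeval_X_mem_supported (by decide) _
  have hPd : P.totalDegree ≤ d := by
    refine (totalDegree_aeval_X_le _ _).trans (le_trans ?_ hp)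
    rw [Polynomial.natDegree_comp]
    refine (Nat.mul_le_mul_left _ ?_).trans_eq (mul_one _)
    exact (Polynomial.natDegree_C_mul_le _ _).trans (Polynomial.natDegree_X_sub_C_le b)
  have e := semiconjBy_elementary (hlow hqs) (hlow hPs) h0 h1 (hPf ▸ h2)
  have hu := isUnit_elementary (neg_mem (hlow hPs))
  rw [← dynamicalDegree_eq_of_semiconjBy three_pos hf hu e]
  have hQs : q + C a₂ * P ∈ supported k (Set.Iio 2) :=
    add_mem hqs (mul_mem (Subalgebra.algebraMap_mem (supported k _) a₂) hPs)
  refine (isMaxQuadraticRoot_dynamicalDegree_of_shift (a₁ := a₁) (e := 0)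
    (isUnit_of_semiconjBy hf hu e) ha₀ hQs rfl rfl ?_)
    |>.isQuadraticOfDegreeLE hd hd fun m hm _ => (apply_add_apply_le_totalDegree hm).trans
      ((totalDegree_add _ _).trans (max_le hq ?_))
  · rw [C_0, add_zero]
    rfl
  · rw [C_mul']
    exact (totalDegree_smul_le _ _).trans hPd

end RotateInv

section Henon

variable {a : k} {p : Polynomial k} {q : MvPolynomial (Fin 3) k} {θ : ℝ}

/-- The generalized Hénon map `(x, y) ↦ (a y + p(x), x)` acting on the first two coordinates. -/
noncomputable def henon (a : k) (p : Polynomial k) : PolyEnd k 3 :=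
  ⟨![C a * X 1 + Polynomial.aeval (X 0) p, X 0, X 2]⟩

/-- The inverse of `henon a p`, for `a ≠ 0`. -/
noncomputable def henonInv (a : k) (p : Polynomial k) : PolyEnd k 3 :=
  ⟨![X 1, C a⁻¹ * (X 0 - Polynomial.aeval (X 1) p), X 2]⟩

theorem bind₁_henonInv_coord_zero_henon (ha : a ≠ 0) :
    bind₁ (henonInv a p).coord (C a * X 1 + Polynomial.aeval (X 0) p) = X 0 := by
  rw [map_add, map_mul, bind₁_C_right, bind₁_X_right, bind₁_aeval, bind₁_X_right]
  change C a * (C a⁻¹ * (X 0 - Polynomial.aeval (X 1) p)) + Polynomial.aeval (X 1) p = X 0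
  rw [← mul_assoc, ← C_mul, mul_inv_cancel₀ ha, C_1, one_mul, sub_add_cancel]

theorem bind₁_henon_coord_one_henonInv (ha : a ≠ 0) :
    bind₁ (henon a p).coord (C a⁻¹ * (X 0 - Polynomial.aeval (X 1) p)) = X 1 := by
  rw [map_mul, map_sub, bind₁_C_right, bind₁_X_right, bind₁_aeval, bind₁_X_right]
  change C a⁻¹ * (C a * X 1 + Polynomial.aeval (X 0) p - Polynomial.aeval (X 0) p) = X 1
  rw [add_sub_cancel_right, ← mul_assoc, ← C_mul, inv_mul_cancel₀ ha, C_1, one_mul]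

theorem henon_mul_henonInv (ha : a ≠ 0) : henon a p * henonInv a p = 1 :=
  PolyEnd.ext <| funext fun
    | 0 => bind₁_henonInv_coord_zero_henon ha
    | 1 => bind₁_X_right _ _
    | 2 => bind₁_X_right _ _

theorem henonInv_mul_henon (ha : a ≠ 0) : henonInv a p * henon a p = 1 :=
  PolyEnd.ext <| funext fun
    | 0 => bind₁_X_right _ _
    | 1 => bind₁_henon_coord_one_henonInv ha
    | 2 => bind₁_X_right _ _

theorem isUnit_henon (ha : a ≠ 0) : IsUnit (henon a p) :=
  ⟨⟨_, _, henon_mul_henonInv ha, henonInv_mul_henon ha⟩, rfl⟩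

theorem coord_henon_mem_weightSubmodule {t : ℝ} (ht : t ≤ θ) (hp : p.natDegree ≤ θ) (i : Fin 3) :
    (henon a p).coord i ∈ weightSubmodule k ![1, t, 0] (Set.Iic ((![θ, 1, 0] : Fin 3 → ℝ) i)) := by
  match i with
  | 0 =>
    have hX := aeval_mem_weightSubmodule (w := ![1, t, 0]) (R := k)
      (X_mem_weightSubmodule (i := 0) Set.self_mem_Iic) zero_le_one p
    rw [show (![1, t, 0] : Fin 3 → ℝ) 0 = 1 from rfl, nsmul_one] at hX
    refine add_mem (C_mul_X_mem_weightSubmodule ?_ a)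
      (weightSubmodule_mono (Set.Iic_subset_Iic.2 hp) hX)
    exact ht
  | 1 => exact X_mem_weightSubmodule (i := 0) (w := ![1, t, 0]) Set.self_mem_Iic
  | 2 => exact X_mem_weightSubmodule (i := 2) (w := ![1, t, 0]) Set.self_mem_Iic

theorem coord_henonInv_mem_weightSubmodule (hp : p.natDegree ≤ θ) (i : Fin 3) :
    (henonInv a p).coord i ∈
      weightSubmodule k ![θ, 1, 0] (Set.Iic ((![1, θ, 0] : Fin 3 → ℝ) i)) := by
  match i with
  | 0 => exact X_mem_weightSubmodule (i := 1) (w := ![θ, 1, 0]) Set.self_mem_Iic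
  | 1 =>
    have hX := aeval_mem_weightSubmodule (w := ![θ, 1, 0]) (R := k)
      (X_mem_weightSubmodule (i := 1) Set.self_mem_Iic) zero_le_one p
    rw [show (![θ, 1, 0] : Fin 3 → ℝ) 1 = 1 from rfl, nsmul_one] at hX
    exact C_mul_mem_weightSubmodule (sub_mem
      (X_mem_weightSubmodule (i := 0) (w := ![θ, 1, 0]) Set.self_mem_Iic)
      (weightSubmodule_mono (Set.Iic_subset_Iic.2 hp) hX)) a⁻¹
  | 2 => exact X_mem_weightSubmodule (i := 2) (w := ![θ, 1, 0]) Set.self_mem_Iic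

/-- If the first two coordinates of `f` are `a * X 1 + p(X 0)` and `a₂ * X 2 + q`, then
conjugation by `henon a p` turns the first coordinate into `a * a₂ * X 2 + henonConj a p q`. -/
noncomputable def henonConj (a : k) (p : Polynomial k) (q : MvPolynomial (Fin 3) k) :
    MvPolynomial (Fin 3) k :=
  C a * bind₁ (henonInv a p).coord q + Polynomial.aeval (X 0) p

theorem henonConj_mem_supported (hq : q ∈ supported k (Set.Iio 2)) :
    henonConj a p q ∈ supported k (Set.Iio 2) := by
  have h1 : X 0 - Polynomial.aeval (X 1) p ∈ supported k (Set.Iio (2 : Fin 3)) :=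
    sub_mem (X_mem_supported.2 (by decide)) (aeval_X_mem_supported (by decide) p)
  have h2 : bind₁ (henonInv a p).coord q ∈ supported k (Set.Iio 2) := by
    refine bind₁_mem_supported (fun i hi => ?_) hq
    match i with
    | 0 => exact X_mem_supported.2 (by decide)
    | 1 => exact mul_mem (Subalgebra.algebraMap_mem (supported k _) a⁻¹) h1
    | 2 => exact absurd hi (by decide)
  exact add_mem (mul_mem (Subalgebra.algebraMap_mem (supported k _) a) h2)
    (aeval_X_mem_supported (by decide) p)

theorem bind₁_henon_henonConj (ha : a ≠ 0) : bind₁ (henon a p).coord (henonConj a p q) =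
    C a * q + Polynomial.aeval ((henon a p).coord 0) p := by
  have hinv : (fun i => bind₁ (henon a p).coord ((henonInv a p).coord i)) = X :=
    congrArg PolyEnd.coord (henonInv_mul_henon ha)
  rw [henonConj, map_add, map_mul, bind₁_C_right, bind₁_aeval, bind₁_X_right, bind₁_bind₁, hinv,
    bind₁_X_left, AlgHom.id_apply]

theorem henonConj_mem_weightSubmodule_iff (ha : a ≠ 0) (hθ : 0 ≤ θ) (hp : p.natDegree ≤ θ)
    {S : Set ℝ} (hS : IsLowerSet S) (hpS : p.natDegree * θ ∈ S) :
    henonConj a p q ∈ weightSubmodule k ![θ, 1, 0] S ↔ q ∈ weightSubmodule k ![1, θ, 0] S := by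
  have hIic : Set.Iic (p.natDegree • θ) ⊆ S := by
    rw [nsmul_eq_mul]
    exact hS.Iic_subset hpS
  constructor
  · intro hQ
    have hbQ := bind₁_mem_weightSubmodule hQ hS fun i _ =>
      coord_henon_mem_weightSubmodule (a := a) le_rfl hp i
    have hq : C a⁻¹ * (bind₁ (henon a p).coord (henonConj a p q) -
        Polynomial.aeval ((henon a p).coord 0) p) = q := by
      rw [bind₁_henon_henonConj ha, add_sub_cancel_right, ← mul_assoc, ← C_mul, inv_mul_cancel₀ ha,
        C_1, one_mul]
    rw [← hq]
    exact C_mul_mem_weightSubmodule (sub_mem hbQ (weightSubmodule_mono hIic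
      (aeval_mem_weightSubmodule (coord_henon_mem_weightSubmodule le_rfl hp 0) hθ p))) a⁻¹
  · intro hq
    refine add_mem (C_mul_mem_weightSubmodule (bind₁_mem_weightSubmodule hq hS fun i _ =>
      coord_henonInv_mem_weightSubmodule hp i) a) (weightSubmodule_mono hIic
      (aeval_mem_weightSubmodule (X_mem_weightSubmodule ?_) hθ p))
    exact Set.self_mem_Iic

theorem isLeadingPart_aeval_coord_zero_henon (hp : 1 ≤ p.natDegree) :
    IsLeadingPart ![1, 0, 0] ((p.natDegree : ℝ) ^ 2)
      (Polynomial.aeval ((henon a p).coord 0) p)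
      (C p.leadingCoeff * (C p.leadingCoeff * X 0 ^ p.natDegree) ^ p.natDegree) := by
  have hc : (0 : ℝ) < p.natDegree := Nat.cast_pos.2 hp
  have hX := (isLeadingPart_X (R := k) (w := (![1, 0, 0] : Fin 3 → ℝ)) 0).aeval one_pos p
  rw [show (![1, 0, 0] : Fin 3 → ℝ) 0 = 1 from rfl, nsmul_one] at hX
  have h0 : IsLeadingPart ![1, 0, 0] (p.natDegree : ℝ) ((henon a p).coord 0)
      (C p.leadingCoeff * X 0 ^ p.natDegree) := by
    change IsLeadingPart _ _ (C a * X 1 + Polynomial.aeval (X 0) p) _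
    rw [add_comm]
    exact hX.add_of_lt (C_mul_X_mem_weightSubmodule (w := ![1, 0, 0]) (Set.mem_Iio.2 hc) a)
  rw [pow_two, ← nsmul_eq_mul]
  exact h0.aeval hc p

theorem natDegree_sq_le_totalDegree_of_henonConj_mem (ha : a ≠ 0) (hp : 1 ≤ p.natDegree)
    (hQ : henonConj a p q ∈
      weightSubmodule k ![(p.natDegree : ℝ), 1, 0] (Set.Iio ((p.natDegree : ℝ) ^ 2))) :
    p.natDegree ^ 2 ≤ q.totalDegree := by
  have hlc : C p.leadingCoeff ≠ (0 : MvPolynomial (Fin 3) k) :=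
    C_ne_zero.2 (Polynomial.leadingCoeff_ne_zero.2 (Polynomial.ne_zero_of_natDegree_gt hp))
  obtain ⟨m, hm, -, hmw⟩ := (isLeadingPart_aeval_coord_zero_henon (a := a) hp).exists_mem_support
    (mul_ne_zero hlc (pow_ne_zero _ (mul_ne_zero hlc (pow_ne_zero _ (X_ne_zero 0)))))
  have hbQ := bind₁_mem_weightSubmodule hQ (isLowerSet_Iio _) fun i _ =>
    coord_henon_mem_weightSubmodule (a := a) (t := 0) (Nat.cast_nonneg _) le_rfl i
  have hmq : m ∈ q.support := by
    rw [← sub_eq_of_eq_add' (bind₁_henon_henonConj ha)] at hm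
    have h := (Finset.mem_union.1 (support_sub _ _ _ hm)).resolve_left fun h =>
      absurd hmw (Set.mem_Iio.1 (mem_weightSubmodule_iff.1 hbQ m h)).ne
    rw [C_mul'] at h
    exact support_smul h
  have hm0 : (m 0 : ℝ) = p.natDegree ^ 2 := by
    rw [weight_fin_three] at hmw
    simpa using hmw
  have hmd := apply_add_apply_le_totalDegree hmq
  have hm0' : m 0 = p.natDegree ^ 2 := by exact_mod_cast hm0
  lia

end Henon

section Rotate

variable {f : PolyEnd k 3} {a₀ a₁ a₂ b : k} {p : Polynomial k} {q : MvPolynomial (Fin 3) k}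
  {θ : ℝ} {d : ℕ}

theorem IsMaxQuadraticRoot.isQuadraticOfDegreeLE_of_lt_natDegree
    (h : IsMaxQuadraticRoot (henonConj a₁ p q) 1 θ) (ha₁ : a₁ ≠ 0)
    (hqs : q ∈ supported k (Set.Iio 2)) (hθ : θ < p.natDegree) (hd : 1 ≤ d)
    (hq : q.totalDegree ≤ d) : IsQuadraticOfDegreeLE d θ := by
  have hθ0 : 0 < θ := one_pos.trans_le h.one_le
  have hp : 1 < p.natDegree := Nat.one_lt_cast.1 (h.one_le.trans_lt hθ)
  have hlt : ∀ m ∈ (henonConj a₁ p q).support,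
      (m 0 : ℝ) * p.natDegree + m 1 < (p.natDegree : ℝ) ^ 2 := by
    intro m hm
    have hle := h.le_sq m hm
    rw [Nat.cast_one, mul_one] at hle
    have hm0 : (m 0 : ℝ) ≤ θ := by
      by_contra! hgt
      nlinarith [(m 1).cast_nonneg (α := ℝ)]
    calc (m 0 : ℝ) * p.natDegree + m 1
        = m 0 * θ + m 1 + m 0 * (p.natDegree - θ) := by ring
      _ ≤ θ ^ 2 + θ * (p.natDegree - θ) :=
          add_le_add hle (mul_le_mul_of_nonneg_right hm0 (sub_pos.2 hθ).le)
      _ = θ * p.natDegree := by ring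
      _ < (p.natDegree : ℝ) ^ 2 := by
          rw [pow_two]
          exact mul_lt_mul_of_pos_right hθ (hθ0.trans hθ)
  have hsq : p.natDegree ^ 2 ≤ d := by
    refine (natDegree_sq_le_totalDegree_of_henonConj_mem ha₁ hp.le
      ((mem_weightSubmodule_iff_of_mem_supported_Iio_two
        (henonConj_mem_supported hqs)).2 fun m hm => ?_)).trans hq
    simpa using hlt m hm
  refine h.isQuadraticOfDegreeLE hd hd fun m hm _ => ?_
  have hm' : m 0 * p.natDegree + m 1 < p.natDegree ^ 2 := by exact_mod_cast hlt m hm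
  have := Nat.le_mul_of_pos_right (m 0) (zero_lt_one.trans hp)
  lia

theorem IsMaxQuadraticRoot.isQuadraticOfDegreeLE_of_natDegree_lt
    (h : IsMaxQuadraticRoot (henonConj a₁ p q) 1 θ) (ha₁ : a₁ ≠ 0)
    (hqs : q ∈ supported k (Set.Iio 2)) (hθ : p.natDegree < θ) (hd : 1 ≤ d)
    (hq : q.totalDegree ≤ d) : IsQuadraticOfDegreeLE d θ := by
  have hθ0 : 0 < θ := one_pos.trans_le h.one_le
  have hpθ : p.natDegree * θ < θ ^ 2 := by
    rw [pow_two]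
    exact mul_lt_mul_of_pos_right hθ hθ0
  have hQs := henonConj_mem_supported (a := a₁) (p := p) hqs
  rcases h.eq_one_or_eq_sq with rfl | ⟨m₀, hm₀, heq⟩
  · exact isQuadraticOfDegreeLE_one hd
  have hle : q ∈ weightSubmodule k ![1, θ, 0] (Set.Iic (θ ^ 2)) := by
    refine (henonConj_mem_weightSubmodule_iff ha₁ hθ0.le hθ.le (isLowerSet_Iic _) hpθ.le).1
      ((mem_weightSubmodule_iff_of_mem_supported_Iio_two hQs).2 fun m hm => ?_)
    simpa using h.le_sq m hm
  have hnlt : q ∉ weightSubmodule k ![1, θ, 0] (Set.Iio (θ ^ 2)) := fun hlt => by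
    have hlt' := (mem_weightSubmodule_iff_of_mem_supported_Iio_two hQs).1
      ((henonConj_mem_weightSubmodule_iff ha₁ hθ0.le hθ.le (isLowerSet_Iio _) hpθ).2 hlt) m₀ hm₀
    refine (Set.mem_Iio.1 hlt').ne ?_
    simpa using heq
  rw [mem_weightSubmodule_iff_of_mem_supported_Iio_two hqs] at hle hnlt
  push Not at hnlt
  obtain ⟨m, hm, hmw⟩ := hnlt
  have hsq := le_antisymm (Set.mem_Iic.1 (hle m hm)) (not_lt.1 fun h => hmw (Set.mem_Iio.2 h))
  refine isQuadraticOfDegreeLE_of_eq_sq hθ0 (a := m 1) (b := m 0) (c := 1) ?_ hd ?_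
  · rw [add_comm]
    exact (apply_add_apply_le_totalDegree hm).trans hq
  · rw [← hsq]
    simp [add_comm]

theorem semiconjBy_henon (h0 : f.coord 0 = C a₁ * X 1 + Polynomial.aeval (X 0) p)
    (ha₁ : a₁ ≠ 0) (h1 : f.coord 1 = C a₂ * X 2 + q) (h2 : f.coord 2 = C a₀ * X 0 + C b) :
    SemiconjBy (henon a₁ p) f
      ⟨![C (a₁ * a₂) * X 2 + henonConj a₁ p q, X 0, C a₀ * X 1 + C b]⟩ := by
  refine PolyEnd.ext (funext fun i => ?_)
  rw [coord_mul, coord_mul]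
  match i with
  | 0 =>
    change bind₁ f.coord (C a₁ * X 1 + Polynomial.aeval (X 0) p) =
      bind₁ (henon a₁ p).coord (C (a₁ * a₂) * X 2 + henonConj a₁ p q)
    rw [map_add, map_add, map_mul, map_mul, bind₁_C_right, bind₁_C_right, bind₁_aeval,
      bind₁_X_right, bind₁_X_right, bind₁_X_right, bind₁_henon_henonConj ha₁, h0, h1, C_mul]
    change _ = C a₁ * C a₂ * X 2 + (C a₁ * q + Polynomial.aeval
      (C a₁ * X 1 + Polynomial.aeval (X 0) p) p)
    ring
  | 1 =>
    change bind₁ f.coord (X 0) = bind₁ (henon a₁ p).coord (X 0)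
    rw [bind₁_X_right, bind₁_X_right, h0]
    rfl
  | 2 =>
    change bind₁ f.coord (X 2) = bind₁ (henon a₁ p).coord (C a₀ * X 1 + C b)
    rw [map_add, map_mul, bind₁_C_right, bind₁_C_right, bind₁_X_right, bind₁_X_right, h2]
    rfl

theorem isMaxQuadraticRoot_dynamicalDegree_of_rotate (hf : IsUnit f) (ha₁ : a₁ ≠ 0)
    (hqs : q ∈ supported k (Set.Iio 2)) (h0 : f.coord 0 = C a₁ * X 1 + Polynomial.aeval (X 0) p)
    (h1 : f.coord 1 = C a₂ * X 2 + q) (h2 : f.coord 2 = C a₀ * X 0 + C b) :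
    IsMaxQuadraticRoot (henonConj a₁ p q) 1 f.dynamicalDegree := by
  have e := semiconjBy_henon h0 ha₁ h1 h2
  rw [← dynamicalDegree_eq_of_semiconjBy three_pos hf (isUnit_henon ha₁) e]
  refine isMaxQuadraticRoot_dynamicalDegree_of_shift (a₀ := 1) (b := 0)
    (isUnit_of_semiconjBy hf (isUnit_henon ha₁) e) one_ne_zero (henonConj_mem_supported hqs)
    rfl ?_ rfl
  rw [C_1, one_mul, C_0, add_zero]
  rfl

theorem isQuadraticOfDegreeLE_of_rotate (hf : IsUnit f) (hd : 1 ≤ d) (ha₁ : a₁ ≠ 0)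
    (hqs : q ∈ supported k (Set.Iio 2)) (hp : p.natDegree ≤ d) (hq : q.totalDegree ≤ d)
    (h0 : f.coord 0 = C a₁ * X 1 + Polynomial.aeval (X 0) p) (h1 : f.coord 1 = C a₂ * X 2 + q)
    (h2 : f.coord 2 = C a₀ * X 0 + C b) : IsQuadraticOfDegreeLE d f.dynamicalDegree := by
  have h := isMaxQuadraticRoot_dynamicalDegree_of_rotate hf ha₁ hqs h0 h1 h2
  rcases lt_trichotomy f.dynamicalDegree p.natDegree with hlt | heq | hgt
  · exact h.isQuadraticOfDegreeLE_of_lt_natDegree ha₁ hqs hlt hd hq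
  · have hp1 : (1 : ℝ) ≤ p.natDegree := heq ▸ h.one_le
    rw [heq]
    exact isQuadraticOfDegreeLE_natCast (Nat.one_le_cast.1 hp1) hp
  · exact h.isQuadraticOfDegreeLE_of_natDegree_lt ha₁ hqs hgt hd hq

end Rotate

section Classification

theorem perm_fin_three_cases (σ : Equiv.Perm (Fin 3)) :
    σ = 1 ∨ (σ 0 = 0 ∧ σ 1 = 2 ∧ σ 2 = 1) ∨ (σ 0 = 1 ∧ σ 1 = 0 ∧ σ 2 = 2) ∨
      (σ 0 = 1 ∧ σ 1 = 2 ∧ σ 2 = 0) ∨ (σ 0 = 2 ∧ σ 1 = 0 ∧ σ 2 = 1) ∨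
      (σ 0 = 2 ∧ σ 1 = 1 ∧ σ 2 = 0) := by
  revert σ
  decide

theorem ofPerm_one : ofPerm k (1 : Equiv.Perm (Fin n)) = 1 := rfl

theorem isQuadraticOfDegreeLE_ofPerm_mul (σ : Equiv.Perm (Fin 3)) {τ : PolyEnd k 3}
    (hτ : τ.IsTriangular) (hu : IsUnit τ) {d : ℕ} (hd : 1 ≤ d) (hτd : τ.degree ≤ d) :
    IsQuadraticOfDegreeLE d (ofPerm k σ * τ).dynamicalDegree := by
  obtain ⟨a₀, a₁, a₂, b, p, q, ha₀, ha₁, -, hqs, h0, h1, h2⟩ := hτ.exists_eq hu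
  have hp : p.natDegree ≤ d :=
    (natDegree_le_totalDegree_aeval_X (0 : Fin 3) p).trans <|
      (totalDegree_le_max_one_totalDegree_C_mul_X_add a₁ 1 _).trans <|
      max_le hd (h1 ▸ (totalDegree_coord_le τ 1).trans hτd)
  have hq : q.totalDegree ≤ d :=
    (totalDegree_le_max_one_totalDegree_C_mul_X_add a₂ 2 q).trans <|
      max_le hd (h2 ▸ (totalDegree_coord_le τ 2).trans hτd)
  have hf : IsUnit (ofPerm k σ * τ) := (isUnit_ofPerm σ).mul hu
  have hc : ∀ {i j r}, σ i = j → τ.coord j = r → (ofPerm k σ * τ).coord i = r := by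
    rintro i _ _ rfl rfl
    exact coord_ofPerm_mul σ τ i
  rcases perm_fin_three_cases σ with rfl | ⟨s0, s1, s2⟩ | ⟨s0, s1, s2⟩ | ⟨s0, s1, s2⟩ |
    ⟨s0, s1, s2⟩ | ⟨s0, s1, s2⟩
  · rw [ofPerm_one, one_mul, hτ.dynamicalDegree_eq_one three_pos hu]
    exact isQuadraticOfDegreeLE_one hd
  · exact isQuadraticOfDegreeLE_of_swap_one_two hf hd ha₀ hqs hq (hc s0 h0) (hc s1 h2) (hc s2 h1)
  · rw [dynamicalDegree_eq_max_natDegree hf hqs (hc s0 h1) (hc s1 h0) (hc s2 h2)]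
    exact isQuadraticOfDegreeLE_natCast (one_pos.trans_le (le_max_left _ _)) (max_le hd hp)
  · exact isQuadraticOfDegreeLE_of_rotate hf hd ha₁ hqs hp hq (hc s0 h1) (hc s1 h2) (hc s2 h0)
  · exact isQuadraticOfDegreeLE_of_rotate_inv hf hd ha₀ hqs hp hq (hc s0 h2) (hc s1 h0) (hc s2 h1)
  · exact isQuadraticOfDegreeLE_of_swap_zero_two hf hd ha₁ hqs hp hq
      (hc s0 h2) (hc s1 h1) (hc s2 h0)

theorem IsAffineTriangular.isQuadraticOfDegreeLE {f : PolyEnd k 3} (hf : IsUnit f)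
    (h : f.IsAffineTriangular) {d : ℕ} (hd : 1 ≤ d) (hfd : f.degree ≤ d) :
    IsQuadraticOfDegreeLE d f.dynamicalDegree := by
  obtain ⟨σ, τ, hτ, hu, hτf, hdyn⟩ := h.exists_conj three_pos hf
  rw [hdyn]
  exact isQuadraticOfDegreeLE_ofPerm_mul σ hτ hu hd (hτf.trans hfd)

end Classification

section Examples

variable {p : Polynomial k} {q : MvPolynomial (Fin 3) k}

theorem isTriangular_elementary {i : Fin n} {b : MvPolynomial (Fin n) k}
    (hb : b ∈ supported k (Set.Iio i)) : (elementary i b).IsTriangular := by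
  intro j
  rcases eq_or_ne j i with rfl | hj
  · rw [coord_elementary_self]
    exact add_mem (X_mem_supported.2 Set.self_mem_Iic) (supported_mono Set.Iio_subset_Iic_self hb)
  · rw [coord_elementary_of_ne hj]
    exact X_mem_supported.2 Set.self_mem_Iic

/-- The triangular automorphism `(X 0, X 1 + p(X 0), X 2 + q)`, for `q` in the first two
variables. -/
noncomputable def unitriangular (p : Polynomial k) (q : MvPolynomial (Fin 3) k) : PolyEnd k 3 :=
  elementary 1 (Polynomial.aeval (X 0) p) * elementary 2 q

theorem coord_unitriangular :
    (unitriangular p q).coord = ![X 0, X 1 + Polynomial.aeval (X 0) p, X 2 + q] := by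
  have h0 : (elementary 2 q).coord 0 = X 0 := coord_elementary_of_ne (by decide) q
  have h1 : (elementary 2 q).coord 1 = X 1 := coord_elementary_of_ne (by decide) q
  funext i
  rw [unitriangular, coord_mul]
  match i with
  | 0 =>
    rw [coord_elementary_of_ne (by decide), bind₁_X_right, h0]
    rfl
  | 1 =>
    rw [coord_elementary_self, map_add, bind₁_X_right, bind₁_aeval, bind₁_X_right, h0, h1]
    rfl
  | 2 =>
    rw [coord_elementary_of_ne (by decide), bind₁_X_right, coord_elementary_self]
    rfl

theorem isUnit_unitriangular (hq : q ∈ supported k (Set.Iio 2)) : IsUnit (unitriangular p q) :=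
  (isUnit_elementary (aeval_X_mem_supported (by decide) p)).mul
    (isUnit_elementary (supported_mono (fun _ hi => ne_of_lt hi) hq))

theorem isTriangular_unitriangular (hq : q ∈ supported k (Set.Iio 2)) :
    (unitriangular p q).IsTriangular :=
  (isTriangular_elementary (aeval_X_mem_supported (by decide) p)).mul (isTriangular_elementary hq)

theorem isUnit_ofPerm_mul_unitriangular (σ : Equiv.Perm (Fin 3))
    (hq : q ∈ supported k (Set.Iio 2)) : IsUnit (ofPerm k σ * unitriangular p q) :=
  (isUnit_ofPerm σ).mul (isUnit_unitriangular hq)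

theorem isAffineTriangular_ofPerm_mul_unitriangular (σ : Equiv.Perm (Fin 3))
    (hq : q ∈ supported k (Set.Iio 2)) : (ofPerm k σ * unitriangular p q).IsAffineTriangular :=
  ⟨_, _, isAffineAut_ofPerm three_pos σ, isTriangular_unitriangular hq, rfl⟩

theorem X_pow_mul_X_pow_mem_supported (a b : ℕ) :
    (X 0 ^ a * X 1 ^ b : MvPolynomial (Fin 3) k) ∈ supported k (Set.Iio 2) :=
  mul_mem (pow_mem (X_mem_supported.2 (by decide)) a) (pow_mem (X_mem_supported.2 (by decide)) b)

theorem support_X_pow_mul_X_pow (a b : ℕ) : (X 0 ^ a * X 1 ^ b : MvPolynomial (Fin 3) k).support =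
    {Finsupp.single 0 a + Finsupp.single 1 b} := by
  classical
  rw [X_pow_eq_monomial, X_pow_eq_monomial, monomial_mul, one_mul, support_monomial,
    if_neg one_ne_zero]

theorem degreeOf_zero_X_pow_mul_X_pow (a b : ℕ) :
    (X 0 ^ a * X 1 ^ b : MvPolynomial (Fin 3) k).degreeOf 0 = a := by
  rw [degreeOf_eq_sup, support_X_pow_mul_X_pow, Finset.sup_singleton]
  simp

/-- The first family of examples in the theorem. -/
noncomputable def swapExample (k : Type*) [Field k] (a b c : ℕ) : PolyEnd k 3 :=
  ⟨![X 2 + X 0 ^ a * X 1 ^ b, X 1 + X 0 ^ c, X 0]⟩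

/-- The second family of examples in the theorem, with `b` for its `b * c`. -/
noncomputable def shiftExample (k : Type*) [Field k] (a b : ℕ) : PolyEnd k 3 :=
  ⟨![X 2 + X 0 ^ a * X 1 ^ b, X 0, X 1]⟩

theorem swapExample_eq (a b c : ℕ) : swapExample k a b c =
    ofPerm k (Equiv.swap 0 2) * unitriangular (Polynomial.X ^ c) (X 0 ^ a * X 1 ^ b) := by
  refine PolyEnd.ext (funext fun i => ?_)
  rw [coord_ofPerm_mul, coord_unitriangular, Polynomial.aeval_X_pow]
  match i with
  | 0 | 1 | 2 => rfl

theorem shiftExample_eq (a b : ℕ) : shiftExample k a b =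
    ofPerm k (finRotate 3)⁻¹ * unitriangular 0 (X 0 ^ a * X 1 ^ b) := by
  refine PolyEnd.ext (funext fun i => ?_)
  rw [coord_ofPerm_mul, coord_unitriangular, map_zero, add_zero]
  match i with
  | 0 | 1 | 2 => rfl

theorem isUnit_swapExample (a b c : ℕ) : IsUnit (swapExample k a b c) :=
  swapExample_eq (k := k) a b c ▸
    isUnit_ofPerm_mul_unitriangular _ (X_pow_mul_X_pow_mem_supported a b)

theorem isAffineTriangular_swapExample (a b c : ℕ) : (swapExample k a b c).IsAffineTriangular :=
  swapExample_eq (k := k) a b c ▸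
    isAffineTriangular_ofPerm_mul_unitriangular _ (X_pow_mul_X_pow_mem_supported a b)

theorem isUnit_shiftExample (a b : ℕ) : IsUnit (shiftExample k a b) :=
  shiftExample_eq (k := k) a b ▸
    isUnit_ofPerm_mul_unitriangular _ (X_pow_mul_X_pow_mem_supported a b)

theorem isAffineTriangular_shiftExample (a b : ℕ) : (shiftExample k a b).IsAffineTriangular :=
  shiftExample_eq (k := k) a b ▸
    isAffineTriangular_ofPerm_mul_unitriangular _ (X_pow_mul_X_pow_mem_supported a b)

theorem degree_swapExample_le {a b c d : ℕ} (hd : 1 ≤ d) (hab : a + b ≤ d) (hc : c ≤ d) :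
    (swapExample k a b c).degree ≤ d := by
  have hX : ∀ i, (X i : MvPolynomial (Fin 3) k).totalDegree ≤ d := fun i => by rwa [totalDegree_X]
  refine Finset.sup_le fun i _ => ?_
  match i with
  | 0 =>
    refine (totalDegree_add _ _).trans (max_le (hX 2) ((totalDegree_mul _ _).trans ?_))
    rwa [totalDegree_X_pow, totalDegree_X_pow]
  | 1 => exact (totalDegree_add _ _).trans (max_le (hX 1) (by rwa [totalDegree_X_pow]))
  | 2 => exact hX 0

theorem IsMaxQuadraticRoot.eq_quadraticRoot {a b c : ℕ} {θ : ℝ}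
    (h : IsMaxQuadraticRoot (X 0 ^ a * X 1 ^ b : MvPolynomial (Fin 3) k) c θ)
    (h0 : quadraticRoot a b c ≠ 0) : θ = quadraticRoot a b c := by
  have hsupp : ∀ m ∈ (X 0 ^ a * X 1 ^ b : MvPolynomial (Fin 3) k).support, m 0 = a ∧ m 1 = b := by
    intro m hm
    rw [support_X_pow_mul_X_pow, Finset.mem_singleton] at hm
    simp [hm]
  rcases h.eq_one_or_eq_sq with rfl | ⟨m, hm, heq⟩
  · have hle := h.le_sq (Finsupp.single 0 a + Finsupp.single 1 b)
      (by rw [support_X_pow_mul_X_pow, Finset.mem_singleton])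
    rw [(hsupp _ (by rw [support_X_pow_mul_X_pow, Finset.mem_singleton])).1,
      (hsupp _ (by rw [support_X_pow_mul_X_pow, Finset.mem_singleton])).2] at hle
    have hbc : (0 : ℝ) ≤ b * c := by positivity
    nlinarith [quadraticRoot_sq a b c, one_le_quadraticRoot h0]
  · rw [(hsupp m hm).1, (hsupp m hm).2] at heq
    exact _root_.eq_quadraticRoot (one_pos.trans_le h.one_le) heq

theorem dynamicalDegree_swapExample {a b c : ℕ} (h : quadraticRoot a b c ≠ 0) :
    (swapExample k a b c).dynamicalDegree = quadraticRoot a b c := by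
  have hf := isUnit_swapExample (k := k) a b c
  have hq := X_pow_mul_X_pow_mem_supported (k := k) a b
  have h0 : (swapExample k a b c).coord 0 = C 1 * X 2 + X 0 ^ a * X 1 ^ b := by
    rw [C_1, one_mul]
    rfl
  rcases Nat.eq_zero_or_pos c with rfl | hc
  · have h1 : (swapExample k a b 0).coord 1 = C 1 * X 1 + C 1 := by
      rw [C_1, one_mul]
      rfl
    have h2 : (swapExample k a b 0).coord 2 =
        C 1 * X 0 + Polynomial.aeval (X 1) (0 : Polynomial k) := by
      rw [C_1, one_mul, map_zero, add_zero]
      rfl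
    rw [quadraticRoot_zero_right] at h ⊢
    rw [dynamicalDegree_eq_of_affine hf one_ne_zero h0 hq h1 h2, degreeOf_zero_X_pow_mul_X_pow,
      max_eq_right (Nat.one_le_iff_ne_zero.2 (Nat.cast_ne_zero.1 h))]
  · have h1 : (swapExample k a b c).coord 1 =
        C 1 * X 1 + Polynomial.aeval (X 0) (Polynomial.X ^ c : Polynomial k) := by
      rw [C_1, one_mul, Polynomial.aeval_X_pow]
      rfl
    have hmax := isMaxQuadraticRoot_dynamicalDegree hf hq h0 h1
      (fun θ _ => X_mem_weightSubmodule (i := 0) Set.self_mem_Iic)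
      (by rwa [Polynomial.natDegree_X_pow])
    rw [Polynomial.natDegree_X_pow] at hmax
    exact hmax.eq_quadraticRoot h

theorem dynamicalDegree_shiftExample {a b : ℕ} (h : quadraticRoot a b 1 ≠ 0) :
    (shiftExample k a b).dynamicalDegree = quadraticRoot a b 1 := by
  refine (isMaxQuadraticRoot_dynamicalDegree_of_shift (a₁ := 1) (a₂ := 1) (b := 0) (e := 0)
    (isUnit_shiftExample a b) one_ne_zero (X_pow_mul_X_pow_mem_supported a b)
    ?_ ?_ ?_).eq_quadraticRoot h
  · rw [C_1, one_mul]
    rfl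
  · rw [C_1, one_mul, C_0, add_zero]
    rfl
  · rw [C_1, one_mul, C_0, add_zero]
    rfl

end Examples

end PolyEnd

theorem theorem1 (k : Type*) [Field k] (d : ℕ) (hd : 2 ≤ d) :
    {l : ℝ | ∃ f : PolyEnd k 3,
        IsUnit f ∧ f.IsAffineTriangular ∧ f.degree ≤ d ∧ f.dynamicalDegree = l} =
      {l : ℝ | ∃ a b c : ℕ, a + b ≤ d ∧ c ≤ d ∧
        l = ((a : ℝ) + √((a : ℝ) ^ 2 + 4 * (b : ℝ) * (c : ℝ))) / 2} \ {0} ∧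
    ∀ (a b c : ℕ) (l : ℝ),
      l = ((a : ℝ) + √((a : ℝ) ^ 2 + 4 * (b : ℝ) * (c : ℝ))) / 2 → l ≠ 0 →
      ∀ f ∈ ({⟨![MvPolynomial.X 2 + MvPolynomial.X 0 ^ a * MvPolynomial.X 1 ^ b,
                MvPolynomial.X 1 + MvPolynomial.X 0 ^ c,
                MvPolynomial.X 0]⟩,
              ⟨![MvPolynomial.X 2 + MvPolynomial.X 0 ^ a * MvPolynomial.X 1 ^ (b * c),
                MvPolynomial.X 0,
                MvPolynomial.X 1]⟩} : Set (PolyEnd k 3)),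
        IsUnit f ∧ f.IsAffineTriangular ∧ f.dynamicalDegree = l := by
  refine ⟨Set.ext fun l => ⟨?_, ?_⟩, ?_⟩
  · rintro ⟨f, hf, hat, hfd, rfl⟩
    exact ⟨hat.isQuadraticOfDegreeLE hf (one_le_two.trans hd) hfd,
      (one_pos.trans_le (PolyEnd.one_le_dynamicalDegree three_pos hf)).ne'⟩
  · rintro ⟨⟨a, b, c, hab, hc, rfl⟩, hl⟩
    exact ⟨PolyEnd.swapExample k a b c, PolyEnd.isUnit_swapExample a b c,
      PolyEnd.isAffineTriangular_swapExample a b c,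
      PolyEnd.degree_swapExample_le (one_le_two.trans hd) hab hc,
      PolyEnd.dynamicalDegree_swapExample hl⟩
  · rintro a b c l rfl hl f (rfl | rfl)
    · exact ⟨PolyEnd.isUnit_swapExample a b c, PolyEnd.isAffineTriangular_swapExample a b c,
        PolyEnd.dynamicalDegree_swapExample hl⟩
    · have h := quadraticRoot_mul_one a b c
      exact ⟨PolyEnd.isUnit_shiftExample a (b * c),
        PolyEnd.isAffineTriangular_shiftExample a (b * c),
        (PolyEnd.dynamicalDegree_shiftExample (h ▸ hl)).trans h⟩
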